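/- Let $H=\mathbb C^d$ and let all maps below be linear maps on $B(H)$. Write $D(\rho\|\sigma)=\mathrm{tr}[\rho(\log\rho-\log\sigma)]$ for the quantum relative entropy ($+\infty$ unless $\ker\sigma\subseteq\ker\rho$) and $H(\rho)=-\mathrm{tr}(\rho\log\rho)$ for the von Neumann entropy. A quantum channel (completely positive trace-preserving map) $\Phi$ is GNS-symmetric with respect to a full-rank state $\sigma$ if $\mathrm{tr}(X\,\Phi^*(Y)\,\sigma)=\mathrm{tr}(\Phi^*(X)\,Y\,\sigma)$ for all $X,Y\in B(H)$, where $\Phi^*$ is the Hilbert–Schmidt adjoint. The peripheral subspace of $\Phi$ is $\mathcal X_\Phi=\mathrm{span}\{X:\Phi(X)=zX\text{ for some }|z|=1\}$, and its peripheral projection $\mathcal P$ is the unique linear map with range $\mathcal X_\Phi$ that fixes every element of $\mathcal X_\Phi$ and is a limit of $\Phi^{n_i}$ along a non-decreasing sequence of integers $n_i$. For a semigroup $(\mathcal T_t)_{t\ge0}$ of channels, $\mathcal P$ is defined in the same way, with $\mathcal X=\mathrm{span}\{X:\text{for every }t\ge0,\ \mathcal T_t(X)=zX\text{ for some }|z|=1\}$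 and limits of $\mathcal T_{t_i}$ along non-decreasing $t_i\ge0$. Define: * $\alpha(\Phi)\in[0,\infty]$ is the supremum of all $a\ge0$ with $D(\Phi(\rho)\|\Phi(\mathcal P(\rho)))\le e^{-a}D(\rho\|\mathcal P(\rho))$ for all states $\rho$, where $\mathcal P$ is the peripheral projection of $\Phi$; and $\alpha_c(\Phi)=\inf_{n\ge1}\alpha(\mathrm{id}_{\mathcal M_n}\otimes\Phi)$. For a semigroup, $\alpha(\mathcal T)$ is the supremum of all $a\ge0$ with $D(\mathcal T_t(\rho)\|\mathcal T_t(\mathcal P(\rho)))\le e^{-at}D(\rho\|\mathcal P(\rho))$ for all states $\rho$ and all $t\ge0$; and $\alpha_c(\mathcal T)=\inf_{n\ge1}\alpha(\mathrm{id}_{\mathcal M_n}\otimes\mathcal T)$. * $\Lambda(\mathcal P)=\inf\{C>0: X\le C\,\mathcal P(X)\text{ for all }X\ge0\}$ and $\Lambda_c(\mathcal P)=\sup_{n\ge1}\Lambda(\mathrm{id}_{\mathcal M_n}\otimes\mathcal P)$. * $\chi(\Phi)=\sup I(X:B)_{(\mathrm{id}_X\otimes\Phi)(\rho)}$ over all classical–quantum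 states $\rho_{XA}=\sum_x p(x)|x\rangle\langle x|\otimes\rho_x$ with finite $X$, where $I(A:B)_\omega=H(\omega_A)+H(\omega_B)-H(\omega_{AB})$. * $I_c(\Phi)=\sup I(A'\rangle B)_{(\mathrm{id}_{A'}\otimes\Phi)(\rho)}$ over all states $\rho_{A'A}$ with $H_{A'}\cong H_A=H$, where $I(A\rangle B)_\omega=H(\omega_B)-H(\omega_{AB})$. **Lemma.** (i) Let $\Phi$ be a quantum channel on $B(H)$ that is GNS-symmetric with respect to a full-rank state, with peripheral projection $\mathcal P$. Then for every integer $t\ge1$, $$\chi(\Phi^{2t})-\chi(\mathcal P)\le e^{-2\alpha(\Phi) t}\log\Lambda(\mathcal P),\qquad I_c(\Phi^{2t})-I_c(\mathcal P)\le e^{-2\alpha_c(\Phi) t}\log\Lambda_c(\mathcal P).$$ (ii) Let $\mathcal T_t=e^{t\mathcal L}$, $t\ge0$, be a semigroup of quantum channels on $B(H)$, all GNS-symmetric with respect to the same full-rank state, with peripheral projection $\mathcal P$. Then for every real $t>0$, $$\chi(\mathcal T_{2t})-\chi(\mathcal P)\le e^{-2\alpha(\mathcal T) t}\log\Lambda(\mathcal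 P),\qquad I_c(\mathcal T_{2t})-I_c(\mathcal P)\le e^{-2\alpha_c(\mathcal T) t}\log\Lambda_c(\mathcal P).$$ (Here $e^{-\infty}=0$.) -/

import Mathlib

namespace QDyn

open Matrix Filter Topology
open scoped ComplexOrder ENNReal NNReal

noncomputable section

/-- Linear maps `B(H) → B(H)` for `H = ℂⁿ`; multiplication is composition, `Φ ^ t` the `t`-fold
composition. -/
abbrev SuperOp (n : Type*) := Module.End ℂ (Matrix n n ℂ)

/-- A state (density operator). -/
def IsState {n : Type*} [Fintype n] (ρ : Matrix n n ℂ) : Prop :=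
  ρ.PosSemidef ∧ ρ.trace = 1

/-- A full-rank (faithful) state. -/
def IsFaithfulState {n : Type*} [Fintype n] (σ : Matrix n n ℂ) : Prop :=
  σ.PosDef ∧ σ.trace = 1

/-- `id_m ⊗ Φ` acting on `B(ℂᵐ ⊗ ℂⁿ)`: `Φ` is applied to each of the `m × m` blocks. -/
def idTensor (m : Type*) {n : Type*} (Φ : SuperOp n) : SuperOp (m × n) where
  toFun X := Matrix.of fun p q => Φ (Matrix.of fun a b => X (p.1, a) (q.1, b)) p.2 q.2
  map_add' X Y := by
    ext p q
    exact congrFun (congrFun (Φ.map_add (Matrix.of fun a b => X (p.1, a) (q.1, b))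
      (Matrix.of fun a b => Y (p.1, a) (q.1, b))) p.2) q.2
  map_smul' c X := by
    ext p q
    exact congrFun (congrFun (Φ.map_smul c (Matrix.of fun a b => X (p.1, a) (q.1, b))) p.2) q.2

open scoped Kronecker in
theorem idTensor_kronecker (m : Type*) {n : Type*} (Φ : SuperOp n) (A : Matrix m m ℂ)
    (B : Matrix n n ℂ) : idTensor m Φ (A ⊗ₖ B) = A ⊗ₖ Φ B := by
  ext p q
  exact congrFun (congrFun (Φ.map_smul (A p.1 q.1) B) p.2) q.2

def IsCompletelyPositive {n : Type*} [Fintype n] (Φ : SuperOp n) : Prop :=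
  ∀ (k : ℕ) (X : Matrix (Fin k × n) (Fin k × n) ℂ),
    X.PosSemidef → (idTensor (Fin k) Φ X).PosSemidef

section CStar

open scoped Matrix.Norms.L2Operator MatrixOrder

theorem nonneg_iff_exists_star_mul_self {A : Type*} [NonUnitalCStarAlgebra A] [PartialOrder A] [StarOrderedRing A] (a : A) :
    0 ≤ a ↔ ∃ b, a = star b * b :=
  CStarAlgebra.nonneg_iff_eq_star_mul_self

theorem cstarMatrix_nonneg_iff {n : Type*} [Fintype n] [DecidableEq n] (k : ℕ)
    (M : CStarMatrix (Fin k) (Fin k) (Matrix n n ℂ)) :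
    0 ≤ M ↔ (Matrix.of fun p q : Fin k × n => M p.1 q.1 p.2 q.2).PosSemidef := by
  have e : 0 ≤ M ↔ ∃ b, M = star b * b :=
    nonneg_iff_exists_star_mul_self M
  rw [← Matrix.nonneg_iff_posSemidef, e, CStarAlgebra.nonneg_iff_eq_star_mul_self]
  constructor
  · rintro ⟨b, rfl⟩
    refine ⟨Matrix.of fun p q : Fin k × n => b p.1 q.1 p.2 q.2, ?_⟩
    ext p q
    simp [CStarMatrix.mul_apply, Matrix.mul_apply, Fintype.sum_prod_type, Matrix.sum_apply, CStarMatrix.star_apply, Matrix.star_apply]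
  · rintro ⟨b, hb⟩
    refine ⟨CStarMatrix.ofMatrix (Matrix.of fun i j => Matrix.of fun a c => b (i,a) (j,c)), ?_⟩
    ext i j a c
    have := congrFun (congrFun hb (i,a)) (j,c)
    simpa [CStarMatrix.mul_apply, Matrix.mul_apply, Fintype.sum_prod_type, Matrix.sum_apply, CStarMatrix.star_apply, Matrix.star_apply] using this

/-- Complete positivity agrees with the notion for maps of C⋆-algebras. -/
theorem isCompletelyPositive_iff {n : Type*} [Fintype n] [DecidableEq n] (Φ : SuperOp n) :
    IsCompletelyPositive Φ ↔
      ∃ Ψ : CompletelyPositiveMap (Matrix n n ℂ) (Matrix n n ℂ), Ψ.toLinearMap = Φ := by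
  constructor
  · intro h
    refine ⟨⟨Φ, fun k M hM => ?_⟩, rfl⟩
    rw [cstarMatrix_nonneg_iff] at hM ⊢
    exact h k _ hM
  · rintro ⟨Ψ, rfl⟩ k X hX
    have := Ψ.map_cstarMatrix_nonneg' k (CStarMatrix.ofMatrix (Matrix.of fun i j => Matrix.of fun a c => X (i,a) (j,c)))
    rw [cstarMatrix_nonneg_iff, cstarMatrix_nonneg_iff] at this
    exact this hX

end CStar

/-- A quantum channel: a completely positive trace-preserving linear map. -/
structure IsChannel {n : Type*} [Fintype n] (Φ : SuperOp n) : Prop where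
  completelyPositive : IsCompletelyPositive Φ
  trace_map : ∀ X, (Φ X).trace = X.trace

/-- The adjoint `Φ^*` for the Hilbert-Schmidt inner product `tr(Y† X)`. -/
def hsAdjoint {n : Type*} [Fintype n] [DecidableEq n] (Φ : SuperOp n) : SuperOp n where
  toFun Y := Matrix.of fun i j => star (Yᴴ * Φ (Matrix.single i j 1)).trace
  map_add' Y Z := by
    ext i j
    simp [Matrix.add_mul]
  map_smul' c Y := by
    ext i j
    simp [Matrix.trace_smul]

theorem trace_hsAdjoint {n : Type*} [Fintype n] [DecidableEq n] (Φ : SuperOp n)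
    (X Y : Matrix n n ℂ) : ((hsAdjoint Φ Y)ᴴ * X).trace = (Yᴴ * Φ X).trace := by
  have h : Φ X = ∑ i, ∑ j, X i j • Φ (Matrix.single i j 1) := by
    conv_lhs => rw [Matrix.matrix_eq_sum_single X]
    simp only [map_sum]
    refine Finset.sum_congr rfl fun i _ => Finset.sum_congr rfl fun j _ => ?_
    rw [← map_smul, Matrix.smul_single, smul_eq_mul, mul_one]
  rw [h]
  simp only [Matrix.mul_sum, Matrix.trace_sum, Matrix.mul_smul, Matrix.trace_smul, smul_eq_mul]
  simp only [Matrix.trace, Matrix.diag, Matrix.mul_apply, Matrix.conjTranspose_apply]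
  rw [Finset.sum_comm]
  refine Finset.sum_congr rfl fun i _ => Finset.sum_congr rfl fun j _ => ?_
  simp [hsAdjoint, Matrix.trace, Matrix.diag, Matrix.mul_apply, mul_comm]

/-- The symmetry `tr(X Φ^*(Y) σ) = tr(Φ^*(X) Y σ)`. -/
def IsGNSSymmetric {n : Type*} [Fintype n] [DecidableEq n] (Φ : SuperOp n) (σ : Matrix n n ℂ) :
    Prop :=
  ∀ X Y : Matrix n n ℂ, (X * hsAdjoint Φ Y * σ).trace = (hsAdjoint Φ X * Y * σ).trace

/-! ### Semigroups -/

/-- `e^{tL}`; the exponential is computed in the algebra of matrices of linear maps with respect to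
the basis of matrix units. -/
def expSemigroup {n : Type*} [Fintype n] [DecidableEq n] (L : SuperOp n) (t : ℝ) : SuperOp n :=
  (LinearMap.toMatrixAlgEquiv (Matrix.stdBasis ℂ n n)).symm
    (NormedSpace.exp ((t : ℂ) • LinearMap.toMatrixAlgEquiv (Matrix.stdBasis ℂ n n) L))

open scoped Matrix.Norms.L2Operator Nat in
theorem hasSum_expSemigroup {n : Type*} [Fintype n] [DecidableEq n] (L : SuperOp n) (t : ℝ)
    (X : Matrix n n ℂ) :
    HasSum (fun k : ℕ => ((t : ℂ) ^ k / (k ! : ℂ)) • (L ^ k) X) (expSemigroup L t X) := by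
  have h := NormedSpace.exp_series_hasSum_exp' (𝕂 := ℂ)
    ((t : ℂ) • LinearMap.toMatrixAlgEquiv (Matrix.stdBasis ℂ n n) L)
  let ev : Matrix (n × n) (n × n) ℂ →ₗ[ℂ] Matrix n n ℂ := (LinearMap.applyₗ X).comp
    (LinearMap.toMatrixAlgEquiv (Matrix.stdBasis ℂ n n)).symm.toLinearMap
  have hev : ∀ k : ℕ, ev ((k ! : ℂ)⁻¹ •
      ((t : ℂ) • LinearMap.toMatrixAlgEquiv (Matrix.stdBasis ℂ n n) L) ^ k) =
      ((t : ℂ) ^ k / (k ! : ℂ)) • (L ^ k) X := fun k => by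
    rw [smul_pow, ← map_pow, smul_smul, map_smul, inv_mul_eq_div]
    exact congrArg (fun A : SuperOp n => ((t : ℂ) ^ k / (k ! : ℂ)) • A X)
      ((LinearMap.toMatrixAlgEquiv (Matrix.stdBasis ℂ n n)).symm_apply_apply (L ^ k))
  have h2 := h.map ev (LinearMap.continuous_of_finiteDimensional ev)
  exact (funext hev : (ev ∘ _) = _) ▸ h2

/-- `L` generates a quantum Markov semigroup: `e^{tL}` is a quantum channel for all `t ≥ 0`. -/
def IsLindbladian {n : Type*} [Fintype n] [DecidableEq n] (L : SuperOp n) : Prop :=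
  ∀ t : ℝ, 0 ≤ t → IsChannel (expSemigroup L t)

/-! ### Peripheral projections -/

def peripheralSubspace {n : Type*} (Φ : SuperOp n) : Submodule ℂ (Matrix n n ℂ) :=
  Submodule.span ℂ {X | ∃ z : ℂ, ‖z‖ = 1 ∧ Φ X = z • X}

/-- The defining properties of the peripheral projection of a channel. -/
structure IsPeripheralProjection {n : Type*} (Φ P : SuperOp n) : Prop where
  range_eq : LinearMap.range P = peripheralSubspace Φ
  exists_tendsto : ∃ k : ℕ → ℕ, Monotone k ∧
    ∀ X, Tendsto (fun i => (Φ ^ k i) X) atTop (𝓝 (P X))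
  fixed : ∀ X ∈ peripheralSubspace Φ, P X = X

/-- The peripheral projection of a channel: the map with the defining properties above (which
determine it uniquely). -/
def peripheralProjection {n : Type*} (Φ : SuperOp n) : SuperOp n :=
  Classical.epsilon (IsPeripheralProjection Φ)

/-- The peripheral subspace of a semigroup `(T_t)_{t ≥ 0}` (only `t ≥ 0` is used). -/
def semigroupPeripheralSubspace {n : Type*} (T : ℝ → SuperOp n) : Submodule ℂ (Matrix n n ℂ) :=
  Submodule.span ℂ {X | ∀ t : ℝ, 0 ≤ t → ∃ z : ℂ, ‖z‖ = 1 ∧ T t X = z • X}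

structure IsSemigroupPeripheralProjection {n : Type*} (T : ℝ → SuperOp n) (P : SuperOp n) :
    Prop where
  range_eq : LinearMap.range P = semigroupPeripheralSubspace T
  exists_tendsto : ∃ s : ℕ → ℝ, Monotone s ∧ (∀ i, 0 ≤ s i) ∧
    ∀ X, Tendsto (fun i => (T (s i)) X) atTop (𝓝 (P X))
  fixed : ∀ X ∈ semigroupPeripheralSubspace T, P X = X

def semigroupPeripheralProjection {n : Type*} (T : ℝ → SuperOp n) : SuperOp n :=
  Classical.epsilon (IsSemigroupPeripheralProjection T)

/-- Two idempotent limits with the same range coincide as soon as they commute. -/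
theorem eq_of_range_eq_of_comm {n : Type*} {P Q : SuperOp n}
    (h : LinearMap.range P = LinearMap.range Q)
    (hP : ∀ X ∈ LinearMap.range P, P X = X) (hQ : ∀ X ∈ LinearMap.range Q, Q X = X)
    (hc : ∀ X, P (Q X) = Q (P X)) : P = Q := by
  ext1 X
  have h1 : P (Q X) = Q X := hP _ (h ▸ LinearMap.mem_range_self Q X)
  have h2 : Q (P X) = P X := hQ _ (h ▸ LinearMap.mem_range_self P X)
  rw [← h2, ← hc, h1]

/-- If all the maps `S i` commute with all the maps `R j`, so do their pointwise limits. -/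
theorem comm_of_tendsto {n : Type*} [Finite n] {S R : ℕ → SuperOp n} {P Q : SuperOp n}
    (hc : ∀ i j X, S i (R j X) = R j (S i X))
    (hS : ∀ X, Tendsto (fun i => S i X) atTop (𝓝 (P X)))
    (hR : ∀ X, Tendsto (fun i => R i X) atTop (𝓝 (Q X))) (X : Matrix n n ℂ) :
    P (Q X) = Q (P X) := by
  have hcont : ∀ A : SuperOp n, Continuous A := fun A =>
    LinearMap.continuous_of_finiteDimensional A
  have h1 : ∀ i Y, S i (Q Y) = Q (S i Y) := fun i Y =>
    tendsto_nhds_unique (((hcont (S i)).tendsto _).comp (hR Y))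
      ((hR (S i Y)).congr fun j => (hc i j Y).symm)
  exact tendsto_nhds_unique (hS (Q X))
    ((((hcont Q).tendsto _).comp (hS X)).congr fun i => (h1 i X).symm)

theorem IsPeripheralProjection.unique {n : Type*} [Finite n] {Φ P Q : SuperOp n}
    (hP : IsPeripheralProjection Φ P) (hQ : IsPeripheralProjection Φ Q) : P = Q := by
  obtain ⟨k, -, hk⟩ := hP.exists_tendsto
  obtain ⟨l, -, hl⟩ := hQ.exists_tendsto
  refine eq_of_range_eq_of_comm (hP.range_eq.trans hQ.range_eq.symm)
    (fun X hX => hP.fixed X (hP.range_eq ▸ hX)) (fun X hX => hQ.fixed X (hQ.range_eq ▸ hX))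
    (comm_of_tendsto (fun i j X => ?_) hk hl)
  rw [← Module.End.mul_apply, ← Module.End.mul_apply, ← pow_add, ← pow_add, add_comm]

theorem IsSemigroupPeripheralProjection.unique {n : Type*} [Finite n] {T : ℝ → SuperOp n}
    (hT : ∀ s t : ℝ, 0 ≤ s → 0 ≤ t → ∀ X, T s (T t X) = T t (T s X)) {P Q : SuperOp n}
    (hP : IsSemigroupPeripheralProjection T P) (hQ : IsSemigroupPeripheralProjection T Q) :
    P = Q := by
  obtain ⟨k, -, hk0, hk⟩ := hP.exists_tendsto
  obtain ⟨l, -, hl0, hl⟩ := hQ.exists_tendsto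
  exact eq_of_range_eq_of_comm (hP.range_eq.trans hQ.range_eq.symm)
    (fun X hX => hP.fixed X (hP.range_eq ▸ hX)) (fun X hX => hQ.fixed X (hQ.range_eq ▸ hX))
    (comm_of_tendsto (fun i j X => hT _ _ (hk0 i) (hl0 j) X) hk hl)

/-! ### Entropic quantities (natural logarithm) -/

/-- Logarithm of a Hermitian matrix by functional calculus (with the convention `log 0 = 0`). -/
def mlog {n : Type*} [Fintype n] [DecidableEq n] (ρ : Matrix n n ℂ) : Matrix n n ℂ :=
  cfc Real.log ρ

/-- Von Neumann entropy `H(ρ) = -tr(ρ log ρ)`. -/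
def entropy {n : Type*} [Fintype n] [DecidableEq n] (ρ : Matrix n n ℂ) : ℝ :=
  -(ρ * mlog ρ).trace.re

open scoped Classical in
/-- Relative entropy `D(ρ‖σ) = tr[ρ (log ρ - log σ)]`, equal to `+∞` unless
`ker σ ⊆ ker ρ`. -/
def relEntropy {n : Type*} [Fintype n] [DecidableEq n] (ρ σ : Matrix n n ℂ) : EReal :=
  if ∀ v, σ *ᵥ v = 0 → ρ *ᵥ v = 0 then ((ρ * (mlog ρ - mlog σ)).trace.re : EReal) else ⊤

/-- The marginal `ω_A` of `ω_{AB}`. -/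
def marginalFst {a b : Type*} [Fintype b] (ω : Matrix (a × b) (a × b) ℂ) : Matrix a a ℂ :=
  Matrix.of fun i j => ∑ x, ω (i, x) (j, x)

/-- The marginal `ω_B` of `ω_{AB}`. -/
def marginalSnd {a b : Type*} [Fintype a] (ω : Matrix (a × b) (a × b) ℂ) : Matrix b b ℂ :=
  Matrix.of fun i j => ∑ x, ω (x, i) (x, j)

/-- `I(A:B)_ω = H(ω_A) + H(ω_B) - H(ω_{AB})`. -/
def mutualInfo {a b : Type*} [Fintype a] [DecidableEq a] [Fintype b] [DecidableEq b]
    (ω : Matrix (a × b) (a × b) ℂ) : ℝ :=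
  entropy (marginalFst ω) + entropy (marginalSnd ω) - entropy ω

/-- `I(A⟩B)_ω = H(ω_B) - H(ω_{AB})`. -/
def coherentInfo {a b : Type*} [Fintype a] [DecidableEq a] [Fintype b] [DecidableEq b]
    (ω : Matrix (a × b) (a × b) ℂ) : ℝ :=
  entropy (marginalSnd ω) - entropy ω

open scoped Kronecker in
/-- The classical-quantum state `∑ x, p(x) |x⟩⟨x| ⊗ ρ_x`. -/
def cqState {n : Type*} {k : ℕ} (p : Fin k → ℝ) (ρ : Fin k → Matrix n n ℂ) :
    Matrix (Fin k × n) (Fin k × n) ℂ :=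
  ∑ x, (p x : ℂ) • (Matrix.single x x (1 : ℂ) ⊗ₖ ρ x)

/-- Holevo information `χ(Φ)`: the supremum of `I(X:B)` over all classical-quantum input states
with a finite classical register `X`. -/
def holevo {n : Type*} [Fintype n] [DecidableEq n] (Φ : SuperOp n) : EReal :=
  sSup {r : EReal | ∃ (k : ℕ) (p : Fin k → ℝ) (ρ : Fin k → Matrix n n ℂ),
    (∀ x, 0 ≤ p x) ∧ ∑ x, p x = 1 ∧ (∀ x, IsState (ρ x)) ∧
    r = (mutualInfo (idTensor (Fin k) Φ (cqState p ρ)) : ℝ)}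

/-- Coherent information `I_c(Φ)`: the supremum of `I(A'⟩B)` over all bipartite input states
`ρ_{A'A}` with `H_{A'} ≅ H_A`. -/
def channelCoherentInfo {n : Type*} [Fintype n] [DecidableEq n] (Φ : SuperOp n) : EReal :=
  sSup {r : EReal | ∃ ρ : Matrix (n × n) (n × n) ℂ,
    IsState ρ ∧ r = (coherentInfo (idTensor n Φ ρ) : ℝ)}

/-! ### Contraction coefficients and Pimsner-Popa constants -/

def HasEntropyContraction {n : Type*} [Fintype n] [DecidableEq n] (Φ : SuperOp n) (a : ℝ) :
    Prop :=
  ∀ ρ, IsState ρ →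
    relEntropy (Φ ρ) (Φ (peripheralProjection Φ ρ)) ≤
      (Real.exp (-a) : EReal) * relEntropy ρ (peripheralProjection Φ ρ)

/-- `α(Φ) ∈ [0, ∞]`; the value `∞` occurs, for instance when `Φ` is its own peripheral
projection. -/
def alpha {n : Type*} [Fintype n] [DecidableEq n] (Φ : SuperOp n) : ℝ≥0∞ :=
  ⨆ (a : ℝ≥0) (_ : HasEntropyContraction Φ a), (a : ℝ≥0∞)

/-- `α_c(Φ) = inf_k α(id_k ⊗ Φ)`. -/
def alphaC {n : Type*} [Fintype n] [DecidableEq n] (Φ : SuperOp n) : ℝ≥0∞ :=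
  ⨅ k : ℕ+, alpha (idTensor (Fin k) Φ)

def HasSemigroupEntropyContraction {n : Type*} [Fintype n] [DecidableEq n] (T : ℝ → SuperOp n)
    (a : ℝ) : Prop :=
  ∀ t : ℝ, 0 ≤ t → ∀ ρ, IsState ρ →
    relEntropy (T t ρ) (T t (semigroupPeripheralProjection T ρ)) ≤
      (Real.exp (-(a * t)) : EReal) * relEntropy ρ (semigroupPeripheralProjection T ρ)

def semigroupAlpha {n : Type*} [Fintype n] [DecidableEq n] (T : ℝ → SuperOp n) : ℝ≥0∞ :=
  ⨆ (a : ℝ≥0) (_ : HasSemigroupEntropyContraction T a), (a : ℝ≥0∞)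

def semigroupAlphaC {n : Type*} [Fintype n] [DecidableEq n] (T : ℝ → SuperOp n) : ℝ≥0∞ :=
  ⨅ k : ℕ+, semigroupAlpha fun t => idTensor (Fin k) (T t)

/-- The Pimsner-Popa constant `Λ(P) = inf {C > 0 | X ≤ C P(X) for all X ≥ 0}`, with
`inf ∅ = ∞`. -/
def pimsnerPopa {n : Type*} [Fintype n] (P : SuperOp n) : ℝ≥0∞ :=
  ⨅ (C : ℝ≥0) (_ : 0 < C ∧ ∀ X : Matrix n n ℂ, X.PosSemidef →
    (((C : ℝ) : ℂ) • P X - X).PosSemidef), (C : ℝ≥0∞)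

/-- `Λ_c(P) = sup_k Λ(id_k ⊗ P)`. -/
def pimsnerPopaC {n : Type*} [Fintype n] (P : SuperOp n) : ℝ≥0∞ :=
  ⨆ k : ℕ+, pimsnerPopa (idTensor (Fin k) P)

/-- `e^{-x}` for `x ∈ [0, ∞]`, with `e^{-∞} = 0`. -/
def expNeg (x : ℝ≥0∞) : EReal := (EReal.exp (-(x : EReal)) : ℝ≥0∞)

end

end QDyn

open QDyn

namespace QDyn

open Matrix Filter Topology
open scoped ComplexOrder ENNReal NNReal

/-! The peripheral projection `P` is an idempotent channel with a faithful invariant state. Equality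
in the Kadison-Schwarz inequality makes the fixed points of its adjoint a *-algebra over which the
adjoint is a bimodule map. It follows that `P 1` is positive definite, commutes with this algebra,
and that every `P ω` with `ω` Hermitian is `Y * P 1` for some Hermitian `Y` in the algebra. Hence
`log P(ω) = log Y + supp(Y) log P(1)`, and since `log Y` is again a fixed point, for `ω ≥ 0` `D(ω‖P
ω) = H(P ω) - H(ω) - tr[(ω - P ω) log P(1)]` (`realRelEntropy_map`).

For `id ⊗ P` the last term involves only the marginal on `B`. Let `Ψ` be a channel with `P Ψ = P`.
Writing the identity for `Ψ ω` and for its marginal and subtracting, the last terms cancel: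
`I(A⟩B)_{Ψω} - I(A⟩B)_{Pω} = D(Ψω‖Pω) - D(Ψω_B‖Pω_B) ≤ D(Ψω‖Pω)`, the inequality being Klein's
(`coherentInfo_sub_le`). Channels leave the classical marginal alone, so mutual information obeys
the same bound, and for classical-quantum inputs the right side is an average over the ensemble
(`holevo_sub_le`).

It remains to bound `D(Ψρ‖Pρ)`. The definition of `α` gives `e^{-2αt} D(ρ‖Pρ)`, and `ρ ≤ Λ Pρ`
together with operator monotonicity of the logarithm gives `D(ρ‖Pρ) ≤ log Λ`
(`realRelEntropy_le_log`).

GNS symmetry enters through the inner product `tr(Y σ⁻¹ X†)`, for which `Φ` is a symmetric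
contraction. Its spectrum is real and lies in `[-1, 1]`, so `Φ^{2i}` converges to `P`, and `Φ²` is
the identity on the range of `P`; this is why even powers satisfy `P Φ^{2t} = P`. In a semigroup the
eigenvalue `-1` cannot occur, and the peripheral projection is that of the time-one map. -/

noncomputable section

/-! ### Functional calculus, Klein's inequality and bounds on relative entropy -/

section Entropy

variable {n : Type*} [Fintype n] [DecidableEq n]

/-- A spectral function of a Hermitian matrix is a real polynomial in the matrix. -/
theorem exists_cfc_eq_aeval {A : Matrix n n ℂ} (hA : A.IsHermitian) (f : ℝ → ℝ) :
    ∃ p : Polynomial ℝ, cfc f A = Polynomial.aeval A p := by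
  have hfin := Matrix.finite_real_spectrum (A := A)
  refine ⟨Lagrange.interpolate hfin.toFinset id f, ?_⟩
  rw [← cfc_polynomial (R := ℝ) _ A hA.isSelfAdjoint]
  refine cfc_congr fun x hx => ?_
  exact (Lagrange.eval_interpolate_at_node (s := hfin.toFinset) (v := id) f
    Function.injective_id.injOn (by simpa using hx)).symm

theorem star_eigenvectorUnitary_mul {A : Matrix n n ℂ} (hA : A.IsHermitian) :
    star (hA.eigenvectorUnitary : Matrix n n ℂ) * A =
      diagonal (RCLike.ofReal ∘ hA.eigenvalues) * star (hA.eigenvectorUnitary : Matrix n n ℂ) := by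
  have h1 := hA.spectral_theorem
  rw [Unitary.conjStarAlgAut_apply] at h1
  have h6 := Unitary.coe_star_mul_self hA.eigenvectorUnitary
  calc _ = star (hA.eigenvectorUnitary : Matrix n n ℂ) * ((hA.eigenvectorUnitary : Matrix n n ℂ) *
          diagonal (RCLike.ofReal ∘ hA.eigenvalues) *
          star (hA.eigenvectorUnitary : Matrix n n ℂ)) := congrArg _ h1
    _ = _ := by rw [← Matrix.mul_assoc, ← Matrix.mul_assoc, h6, Matrix.one_mul]

theorem cfc_mulVec_of_eigenvector {A : Matrix n n ℂ} (hA : A.IsHermitian) (f : ℝ → ℝ) {a : ℝ}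
    {v : n → ℂ} (hv : A *ᵥ v = (a : ℂ) • v) : cfc f A *ᵥ v = (f a : ℂ) • v := by
  have hc : ∀ i, hA.eigenvalues i ≠ a →
      ((star (hA.eigenvectorUnitary : Matrix n n ℂ)) *ᵥ v) i = 0 := fun i hi => by
    have h2 : star (hA.eigenvectorUnitary : Matrix n n ℂ) *ᵥ (A *ᵥ v) =
        diagonal (RCLike.ofReal ∘ hA.eigenvalues) *ᵥ
          (star (hA.eigenvectorUnitary : Matrix n n ℂ) *ᵥ v) := by
      rw [mulVec_mulVec, mulVec_mulVec, star_eigenvectorUnitary_mul]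
    rw [hv, mulVec_smul] at h2
    have h3 := congrFun h2 i
    rw [mulVec_diagonal] at h3
    simp only [Pi.smul_apply, smul_eq_mul, Function.comp] at h3
    have h4 : ((a : ℂ) - hA.eigenvalues i) *
      (star (hA.eigenvectorUnitary : Matrix n n ℂ) *ᵥ v) i = 0 := by
        rw [sub_mul, h3]; simp
    refine (mul_eq_zero.1 h4).resolve_left fun h => hi ?_
    exact_mod_cast (sub_eq_zero.1 h).symm
  rw [hA.cfc_eq, Matrix.IsHermitian.cfc, Unitary.conjStarAlgAut_apply, ← mulVec_mulVec,
    ← mulVec_mulVec]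
  have h5 : diagonal (RCLike.ofReal ∘ f ∘ hA.eigenvalues) *ᵥ
      (star (hA.eigenvectorUnitary : Matrix n n ℂ) *ᵥ v) =
      (f a : ℂ) • (star (hA.eigenvectorUnitary : Matrix n n ℂ) *ᵥ v) := by
    ext i
    rw [mulVec_diagonal]
    by_cases hi : hA.eigenvalues i = a
    · simp [hi]
    · simp [hc i hi]
  rw [h5, mulVec_smul, mulVec_mulVec]
  erw [Unitary.coe_mul_star_self hA.eigenvectorUnitary]
  rw [one_mulVec]

/-- Reduces trace inequalities between functions of two noncommuting matrices to scalar
inequalities, weighted by the squared overlaps of the two eigenbases. -/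
theorem trace_cfc_mul_cfc {A B : Matrix n n ℂ} (hA : A.IsHermitian) (hB : B.IsHermitian)
    (f g : ℝ → ℝ) : (cfc f A * cfc g B).trace.re = ∑ i, ∑ j,
      f (hA.eigenvalues i) * g (hB.eigenvalues j) * ‖(star (hA.eigenvectorUnitary : Matrix n n ℂ) *
        (hB.eigenvectorUnitary : Matrix n n ℂ)) i j‖ ^ 2 := by
  rw [hA.cfc_eq, hB.cfc_eq, Matrix.IsHermitian.cfc, Matrix.IsHermitian.cfc,
    Unitary.conjStarAlgAut_apply, Unitary.conjStarAlgAut_apply]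
  set U := (hA.eigenvectorUnitary : Matrix n n ℂ)
  set V := (hB.eigenvectorUnitary : Matrix n n ℂ)
  have h : (U * diagonal (RCLike.ofReal ∘ f ∘ hA.eigenvalues) * star U *
      (V * diagonal (RCLike.ofReal ∘ g ∘ hB.eigenvalues) * star V)).trace =
      (diagonal (RCLike.ofReal ∘ f ∘ hA.eigenvalues) * (star U * V) *
        diagonal (RCLike.ofReal ∘ g ∘ hB.eigenvalues) * (star U * V)ᴴ).trace := by
    rw [conjTranspose_mul, star_eq_conjTranspose, star_eq_conjTranspose, conjTranspose_conjTranspose]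
    simp only [Matrix.mul_assoc]
    rw [Matrix.trace_mul_comm]
    simp only [Matrix.mul_assoc]
  rw [h]
  generalize star U * V = W
  rw [Matrix.trace, Complex.re_sum]
  refine Finset.sum_congr rfl fun i _ => ?_
  rw [Matrix.diag, Matrix.mul_apply, Complex.re_sum]
  refine Finset.sum_congr rfl fun j _ => ?_
  rw [mul_diagonal, diagonal_mul, conjTranspose_apply]
  have : W i j * star (W i j) = ((‖W i j‖ ^ 2 : ℝ) : ℂ) := by
    simpa using Complex.mul_conj' (W i j)
  rw [mul_right_comm, mul_assoc _ (W i j) (star _), this]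
  simp only [Function.comp, Complex.coe_algebraMap]
  norm_cast
  ring

theorem entropy_eq_trace_cfc {ρ : Matrix n n ℂ} (hρ : ρ.IsHermitian) :
    entropy ρ = (cfc Real.negMulLog ρ).trace.re := by
  have h : ρ * mlog ρ = cfc (fun x => x * Real.log x) ρ := by
    rw [cfc_mul (fun x => x) Real.log ρ (by fun_prop)
      (Set.Finite.continuousOn (Matrix.finite_real_spectrum) _), cfc_id' ℝ ρ hρ.isSelfAdjoint, mlog]
  have h2 : cfc Real.negMulLog ρ = - cfc (fun x => x * Real.log x) ρ := by
    rw [← cfc_neg]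
    refine cfc_congr fun x _ => by simp [Real.negMulLog]
  rw [entropy, h, h2, Matrix.trace_neg, Complex.neg_re]

/-- `tr[ρ (log ρ - log σ)]`, regardless of the supports. -/
def realRelEntropy (ρ σ : Matrix n n ℂ) : ℝ := (ρ * (mlog ρ - mlog σ)).trace.re

theorem relEntropy_of_ker_le {ρ σ : Matrix n n ℂ} (h : ∀ v, σ *ᵥ v = 0 → ρ *ᵥ v = 0) :
    relEntropy ρ σ = (realRelEntropy ρ σ : EReal) := by
  rw [relEntropy, if_pos h, realRelEntropy]

section Order

open scoped Matrix.Norms.L2Operator MatrixOrder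

theorem trace_mul_nonneg {A B : Matrix n n ℂ} (hA : A.PosSemidef) (hB : B.PosSemidef) :
    0 ≤ (A * B).trace := by
  obtain ⟨S, rfl⟩ := CStarAlgebra.nonneg_iff_eq_star_mul_self.1 (nonneg_iff_posSemidef.2 hA)
  rw [Matrix.mul_assoc, Matrix.trace_mul_comm]
  exact (hB.mul_mul_conjTranspose_same S).trace_nonneg

theorem mul_eq_zero_of_trace_mul_eq_zero {A B : Matrix n n ℂ} (hA : A.PosSemidef)
    (hB : B.PosSemidef) (h : (A * B).trace = 0) : A * B = 0 := by
  obtain ⟨S, rfl⟩ := CStarAlgebra.nonneg_iff_eq_star_mul_self.1 (nonneg_iff_posSemidef.2 hA)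
  obtain ⟨R, rfl⟩ := CStarAlgebra.nonneg_iff_eq_star_mul_self.1 (nonneg_iff_posSemidef.2 hB)
  have h1 : (S * star R)ᴴ * (S * star R) = R * (star S * S * star R) := by
    simp [star_eq_conjTranspose, Matrix.mul_assoc]
  have h2 : S * star R = 0 := by
    rw [← trace_conjTranspose_mul_self_eq_zero_iff, h1, Matrix.trace_mul_comm, Matrix.mul_assoc]
    exact h
  rw [Matrix.mul_assoc, ← Matrix.mul_assoc S, h2, Matrix.zero_mul, Matrix.mul_zero]

theorem cfc_log_le_cfc_log {A B : Matrix n n ℂ} (hA : A.PosDef) (hAB : (B - A).PosSemidef) :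
    (mlog B - mlog A).PosSemidef := by
  have h := CFC.log_le_log (le_iff.2 hAB) (isStrictlyPositive_iff_posDef.2 hA)
  exact le_iff.1 h

end Order

/-- An eigenvector of `τ` for the eigenvalue `0` is killed by `ρ`, hence orthogonal to the
eigenvectors of `ρ` with nonzero eigenvalue. This makes the convention `log 0 = 0` harmless. -/
theorem eigenvalues_mul_overlap_eq_zero {ρ τ : Matrix n n ℂ} (hρ : ρ.IsHermitian)
    (hτ : τ.IsHermitian) (hker : ∀ v, τ *ᵥ v = 0 → ρ *ᵥ v = 0) (i j : n)
    (hj : hτ.eigenvalues j = 0) :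
    hρ.eigenvalues i * ‖(star (hρ.eigenvectorUnitary : Matrix n n ℂ) *
        (hτ.eigenvectorUnitary : Matrix n n ℂ)) i j‖ ^ 2 = 0 := by
  have h1 : τ *ᵥ (hτ.eigenvectorBasis j) = 0 := by
    rw [hτ.mulVec_eigenvectorBasis, hj, zero_smul]
  have h2 := congrArg (fun v => (star (hρ.eigenvectorUnitary : Matrix n n ℂ)) *ᵥ v) (hker _ h1)
  simp only [mulVec_mulVec, star_eigenvectorUnitary_mul, mulVec_zero] at h2
  rw [← hτ.eigenvectorUnitary_mulVec] at h2
  have h3 := congrFun h2 i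
  rw [← mulVec_mulVec, mulVec_diagonal, mulVec_mulVec, mulVec_single_one] at h3
  rcases mul_eq_zero.1 h3 with h | h
  · have : hρ.eigenvalues i = 0 := by simpa using h
    rw [this, zero_mul]
  · have h' : (star (hρ.eigenvectorUnitary : Matrix n n ℂ) *
        (hτ.eigenvectorUnitary : Matrix n n ℂ)) i j = 0 := h
    rw [h']
    simp

theorem continuousOn_spectrum (A : Matrix n n ℂ) (f : ℝ → ℝ) : ContinuousOn f (spectrum ℝ A) :=
  Set.Finite.continuousOn Matrix.finite_real_spectrum f

theorem mul_cfc {ρ : Matrix n n ℂ} (hρ : ρ.IsHermitian) (f : ℝ → ℝ) :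
    ρ * cfc f ρ = cfc (fun x => x * f x) ρ := by
  rw [cfc_mul (fun x => x) f ρ (by fun_prop) (continuousOn_spectrum _ _),
    cfc_id' ℝ ρ hρ.isSelfAdjoint]

theorem realRelEntropy_eq {ρ τ : Matrix n n ℂ} :
    realRelEntropy ρ τ = -entropy ρ - (ρ * mlog τ).trace.re := by
  simp [realRelEntropy, entropy, Matrix.mul_sub]

/-- Klein's inequality. -/
theorem sub_le_realRelEntropy {ρ τ : Matrix n n ℂ} (hρ : ρ.PosSemidef) (hτ : τ.PosSemidef)
    (hker : ∀ v, τ *ᵥ v = 0 → ρ *ᵥ v = 0) :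
    ρ.trace.re - τ.trace.re ≤ realRelEntropy ρ τ := by
  -- Inserting constant functions `1` brings all four traces to the form `tr f(ρ) g(τ)`, so that
  -- they share the same weights.
  have e1 : (ρ * mlog ρ).trace.re = (cfc (fun x => x * Real.log x) ρ * cfc (fun _ => (1 : ℝ)) τ).trace.re := by
    rw [mlog, mul_cfc hρ.1, cfc_const_one ℝ τ hτ.1.isSelfAdjoint, Matrix.mul_one]
  have e2 : (ρ * mlog τ).trace.re = (cfc (fun x : ℝ => x) ρ * cfc Real.log τ).trace.re := by
    rw [cfc_id' ℝ ρ hρ.1.isSelfAdjoint, mlog]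
  have e3 : ρ.trace.re = (cfc (fun x : ℝ => x) ρ * cfc (fun _ => (1 : ℝ)) τ).trace.re := by
    rw [cfc_id' ℝ ρ hρ.1.isSelfAdjoint, cfc_const_one ℝ τ hτ.1.isSelfAdjoint, Matrix.mul_one]
  have e4 : τ.trace.re = (cfc (fun _ => (1 : ℝ)) ρ * cfc (fun x : ℝ => x) τ).trace.re := by
    rw [cfc_id' ℝ τ hτ.1.isSelfAdjoint, cfc_const_one ℝ ρ hρ.1.isSelfAdjoint, Matrix.one_mul]
  rw [realRelEntropy, Matrix.mul_sub, Matrix.trace_sub, Complex.sub_re, e1, e2, e3, e4]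
  simp only [trace_cfc_mul_cfc hρ.1 hτ.1]
  simp only [← Finset.sum_sub_distrib]
  refine Finset.sum_le_sum fun i _ => Finset.sum_le_sum fun j _ => ?_
  have h0 := eigenvalues_mul_overlap_eq_zero hρ.1 hτ.1 hker i j
  have hw : 0 ≤ ‖(star (hρ.1.eigenvectorUnitary : Matrix n n ℂ) *
        (hτ.1.eigenvectorUnitary : Matrix n n ℂ)) i j‖ ^ 2 := by positivity
  generalize ‖(star (hρ.1.eigenvectorUnitary : Matrix n n ℂ) *
        (hτ.1.eigenvectorUnitary : Matrix n n ℂ)) i j‖ ^ 2 = w at *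
  have hr := hρ.eigenvalues_nonneg i
  have hl := hτ.eigenvalues_nonneg j
  generalize hρ.1.eigenvalues i = r at *
  generalize hτ.1.eigenvalues j = l at *
  rcases hl.eq_or_lt with hl0 | hl0
  · subst hl0
    have := h0 rfl
    rw [Real.log_zero]
    linear_combination (1 - Real.log r) * this
  rcases hr.eq_or_lt with hr0 | hr0
  · subst hr0
    simp
    positivity
  -- The scalar form of Klein's inequality: `r (log l - log r) ≤ l - r`.
  · have h1 := Real.log_le_sub_one_of_pos (div_pos hl0 hr0)
    rw [Real.log_div hl0.ne' hr0.ne'] at h1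
    have h2 : r * (Real.log l - Real.log r) ≤ l - r := by
      calc _ ≤ r * (l / r - 1) := mul_le_mul_of_nonneg_left h1 hr
        _ = _ := by field_simp
    nlinarith [mul_le_mul_of_nonneg_right h2 hw]

omit [Fintype n] [DecidableEq n] in
theorem posSemidef_ofReal_smul {A : Matrix n n ℂ} (hA : A.PosSemidef) {c : ℝ} (hc : 0 ≤ c) :
    ((c : ℂ) • A).PosSemidef :=
  hA.smul (by exact_mod_cast hc)

omit [DecidableEq n] in
theorem ker_le_of_posSemidef_smul_sub {ρ τ : Matrix n n ℂ} (hρ : ρ.PosSemidef) {C : ℝ}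
    (h : ((C : ℂ) • τ - ρ).PosSemidef) (v : n → ℂ) (hv : τ *ᵥ v = 0) : ρ *ᵥ v = 0 := by
  have h1 := h.dotProduct_mulVec_nonneg v
  rw [sub_mulVec, smul_mulVec, hv, smul_zero, zero_sub, dotProduct_neg] at h1
  exact (hρ.dotProduct_mulVec_zero_iff v).1
    (le_antisymm (neg_nonneg.1 h1) (hρ.dotProduct_mulVec_nonneg v))

/-- `D(ρ‖τ) ≤ log C` for a state `ρ ≤ C τ`. -/
theorem realRelEntropy_le_log {ρ τ : Matrix n n ℂ} (hρ : IsState ρ) (hτ : τ.PosSemidef) {C : ℝ}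
    (hC : 0 < C) (h : ((C : ℂ) • τ - ρ).PosSemidef) : realRelEntropy ρ τ ≤ Real.log C := by
  obtain ⟨hρ, htr⟩ := hρ
  have hker := ker_le_of_posSemidef_smul_sub hρ h
  -- Monotonicity of the logarithm needs a positive definite lower matrix, so both sides of `ρ ≤ C
  -- τ` are shifted by `ε`.
  have key : ∀ ε : ℝ, 0 < ε → (ρ * mlog ρ).trace.re ≤ (cfc (fun x : ℝ => x) ρ *
      cfc (fun x => Real.log (C * x + ε)) τ).trace.re := fun ε hε => by
    have a1 : mlog (ρ + algebraMap ℝ _ ε) = cfc (fun x => Real.log (x + ε)) ρ := by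
      rw [mlog, cfc_comp' Real.log (fun x => x + ε) ρ (Set.Finite.continuousOn
        (Set.Finite.image _ Matrix.finite_real_spectrum) _) (by fun_prop) hρ.1.isSelfAdjoint,
        cfc_add_const ε (fun x => x) ρ (by fun_prop) hρ.1.isSelfAdjoint,
        cfc_id' ℝ ρ hρ.1.isSelfAdjoint]
    have a2 : mlog ((C : ℂ) • τ + algebraMap ℝ _ ε) = cfc (fun x => Real.log (C * x + ε)) τ := by
      rw [mlog, cfc_comp' Real.log (fun x => C * x + ε) τ (Set.Finite.continuousOn
        (Set.Finite.image _ Matrix.finite_real_spectrum) _) (by fun_prop) hτ.1.isSelfAdjoint,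
        cfc_add_const ε (fun x => C * x) τ (by fun_prop) hτ.1.isSelfAdjoint,
        cfc_const_mul_id C τ hτ.1.isSelfAdjoint]
      rfl
    have hpd : (ρ + algebraMap ℝ (Matrix n n ℂ) ε).PosDef := by
      rw [Algebra.algebraMap_eq_smul_one]
      exact Matrix.PosDef.posSemidef_add hρ (Matrix.PosDef.one.smul hε)
    have a3 := cfc_log_le_cfc_log (B := (C : ℂ) • τ + algebraMap ℝ _ ε) hpd (by simpa using h)
    rw [a1, a2] at a3
    have a4 := (Complex.le_def.1 (trace_mul_nonneg hρ a3)).1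
    rw [Matrix.mul_sub, Matrix.trace_sub] at a4
    -- Shifting inside the logarithm can only increase `r log r` for an eigenvalue `r > 0`; for `r =
    -- 0` both terms vanish.
    have a5 : (ρ * mlog ρ).trace.re ≤ (ρ * cfc (fun x => Real.log (x + ε)) ρ).trace.re := by
      have b1 : (ρ * cfc (fun x => Real.log (x + ε)) ρ).trace.re = (cfc (fun x => x * Real.log (x + ε)) ρ
          * cfc (fun _ => (1 : ℝ)) ρ).trace.re := by
        rw [mul_cfc hρ.1, cfc_const_one ℝ ρ hρ.1.isSelfAdjoint, Matrix.mul_one]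
      have b2 : (ρ * mlog ρ).trace.re = (cfc (fun x => x * Real.log x) ρ
          * cfc (fun _ => (1 : ℝ)) ρ).trace.re := by
        rw [mlog, mul_cfc hρ.1, cfc_const_one ℝ ρ hρ.1.isSelfAdjoint, Matrix.mul_one]
      rw [b1, b2, trace_cfc_mul_cfc hρ.1 hρ.1, trace_cfc_mul_cfc hρ.1 hρ.1]
      refine Finset.sum_le_sum fun i _ => Finset.sum_le_sum fun j _ => ?_
      refine mul_le_mul_of_nonneg_right ?_ (by positivity)
      simp only [mul_one]
      have hr := hρ.eigenvalues_nonneg i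
      rcases hr.eq_or_lt with hr0 | hr0
      · simp [← hr0]
      · exact mul_le_mul_of_nonneg_left (Real.log_le_log hr0 (by linarith)) hr
    rw [cfc_id' ℝ ρ hρ.1.isSelfAdjoint]
    simp at a4
    linarith
  -- As `ε → 0` the only divergent terms, those with `log ε`, sit at zero eigenvalues of `τ`, where
  -- the weight vanishes. Elsewhere the limit is `log C + log l`.
  have lim : Tendsto (fun ε => (cfc (fun x : ℝ => x) ρ *
      cfc (fun x => Real.log (C * x + ε)) τ).trace.re) (𝓝[>] 0)
      (𝓝 (Real.log C + (ρ * mlog τ).trace.re)) := by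
    have e2 : (ρ * mlog τ).trace.re = (cfc (fun x : ℝ => x) ρ * cfc Real.log τ).trace.re := by
      rw [cfc_id' ℝ ρ hρ.1.isSelfAdjoint, mlog]
    have e3 : Real.log C = (cfc (fun x : ℝ => x) ρ * cfc (fun _ => Real.log C) τ).trace.re := by
      rw [cfc_id' ℝ ρ hρ.1.isSelfAdjoint, cfc_const _ τ hτ.1.isSelfAdjoint,
        Algebra.algebraMap_eq_smul_one, Matrix.mul_smul, Matrix.mul_one, Matrix.trace_smul, htr]
      simp
    rw [e2, e3]
    simp only [trace_cfc_mul_cfc hρ.1 hτ.1]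
    simp only [← Finset.sum_add_distrib]
    refine tendsto_finsetSum _ fun i _ => tendsto_finsetSum _ fun j _ => ?_
    have h0 := eigenvalues_mul_overlap_eq_zero hρ.1 hτ.1 hker i j
    have hl := hτ.eigenvalues_nonneg j
    rcases hl.eq_or_lt with hl0 | hl0
    · have h1 := h0 hl0.symm
      have : ∀ x : ℝ, hρ.1.eigenvalues i * x * ‖(star (hρ.1.eigenvectorUnitary : Matrix n n ℂ) *
        (hτ.1.eigenvectorUnitary : Matrix n n ℂ)) i j‖ ^ 2 = 0 := fun x => by
        rw [mul_right_comm, h1, zero_mul]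
      simp only [this, add_zero]
      exact tendsto_const_nhds
    · rw [← add_mul, ← mul_add, ← Real.log_mul hC.ne' hl0.ne']
      refine Tendsto.mul_const _ (Tendsto.const_mul _ ?_)
      have hc : ContinuousAt (fun ε : ℝ => Real.log (C * hτ.1.eigenvalues j + ε)) 0 :=
        ContinuousAt.log (by fun_prop) (by simp [hC.ne', hl0.ne'])
      have := hc.tendsto
      simp only [add_zero] at this
      exact this.mono_left nhdsWithin_le_nhds
  have := ge_of_tendsto lim (by filter_upwards [self_mem_nhdsWithin] with ε hε using key ε hε)
  rw [realRelEntropy_eq, entropy]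
  linarith

/-- Follows from `negMulLog (c x) = c negMulLog x + x negMulLog c` on the spectrum. -/
theorem entropy_real_smul {ρ : Matrix n n ℂ} (hρ : ρ.IsHermitian) {c : ℝ} :
    entropy ((c : ℂ) • ρ) = c * entropy ρ + Real.negMulLog c * ρ.trace.re := by
  have h1 : (c : ℂ) • ρ = cfc (fun x => c * x) ρ := by
    rw [cfc_const_mul_id c ρ hρ.isSelfAdjoint]; rfl
  have h2 : ((c : ℂ) • ρ).IsHermitian := by
    rw [h1]
    exact cfc_predicate _ ρ
  rw [entropy_eq_trace_cfc hρ, entropy_eq_trace_cfc h2, h1, ← cfc_comp' Real.negMulLog (fun x => c * x) ρ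
    (by fun_prop) (by fun_prop) hρ.isSelfAdjoint]
  have h3 : cfc (fun x => Real.negMulLog (c * x)) ρ =
      (c : ℂ) • cfc Real.negMulLog ρ + (Real.negMulLog c : ℂ) • ρ := by
    have e1 : (c : ℂ) • cfc Real.negMulLog ρ = cfc (fun x => c * Real.negMulLog x) ρ := by
      rw [cfc_const_mul c Real.negMulLog ρ (by fun_prop)]; rfl
    have e2 : (Real.negMulLog c : ℂ) • ρ = cfc (fun x => Real.negMulLog c * x) ρ := by
      rw [cfc_const_mul_id _ ρ hρ.isSelfAdjoint]; rfl
    rw [e1, e2, ← cfc_add ρ _ _ (continuousOn_spectrum _ _) (continuousOn_spectrum _ _)]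
    refine cfc_congr fun x _ => ?_
    simp only [Real.negMulLog_mul]
    ring
  rw [h3]
  simp

/-- The block diagonal matrix `∑ x, |x⟩⟨x| ⊗ M x`. -/
def blockSum {k : Type*} [DecidableEq k] (M : k → Matrix n n ℂ) :
    Matrix (k × n) (k × n) ℂ := Matrix.of fun p q => if p.1 = q.1 then M p.1 p.2 q.2 else 0

/-- As an algebra homomorphism, the block sum commutes with polynomials and hence with functional
calculus. -/
def blockSumAlgHom (k n : Type*) [Fintype k] [DecidableEq k] [Fintype n] [DecidableEq n] :
    (k → Matrix n n ℂ) →ₐ[ℝ] Matrix (k × n) (k × n) ℂ :=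
  AlgHom.ofLinearMap
    { toFun := blockSum
      map_add' := fun M N => by
        ext p q
        by_cases h : p.1 = q.1 <;> simp [blockSum, h]
      map_smul' := fun c M => by
        ext p q
        by_cases h : p.1 = q.1 <;> simp [blockSum, h] }
    (by
      ext p q
      by_cases h : p.1 = q.1 <;> simp [blockSum, h, Matrix.one_apply, Prod.ext_iff])
    (fun M N => by
      ext p q
      by_cases h : p.1 = q.1 <;>
        simp [blockSum, h, Matrix.mul_apply, Fintype.sum_prod_type])

theorem blockSumAlgHom_apply {k : Type*} [Fintype k] [DecidableEq k] (M : k → Matrix n n ℂ) :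
    blockSumAlgHom k n M = blockSum M := rfl

omit [DecidableEq n] in
theorem trace_blockSum {k : Type*} [Fintype k] [DecidableEq k] (M : k → Matrix n n ℂ) :
    (blockSum M).trace = ∑ x, (M x).trace := by
  simp [Matrix.trace, blockSum, Fintype.sum_prod_type]

omit [Fintype n] [DecidableEq n] in
theorem blockSum_isHermitian {k : Type*} [DecidableEq k] {M : k → Matrix n n ℂ}
    (hM : ∀ x, (M x).IsHermitian) : (blockSum M).IsHermitian := by
  ext p q
  simp only [blockSum, conjTranspose_apply, of_apply]
  by_cases h : p.1 = q.1
  · rw [if_pos h, if_pos h.symm, h]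
    exact (hM q.1).apply _ _
  · rw [if_neg h, if_neg (Ne.symm h), star_zero]

theorem cfc_blockSum {k : Type*} [Fintype k] [DecidableEq k] {M : k → Matrix n n ℂ}
    (hM : ∀ x, (M x).IsHermitian) (f : ℝ → ℝ) :
    cfc f (blockSum M) = blockSum fun x => cfc f (M x) := by
  -- A single polynomial has to interpolate `f` on the spectra of the block sum and of all blocks at
  -- once.
  have hfin : (spectrum ℝ (blockSum M) ∪ ⋃ x, spectrum ℝ (M x)).Finite :=
    Matrix.finite_real_spectrum.union (Set.finite_iUnion fun x => Matrix.finite_real_spectrum)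
  have hp : ∀ x ∈ spectrum ℝ (blockSum M) ∪ ⋃ x, spectrum ℝ (M x), f x =
      (Lagrange.interpolate hfin.toFinset id f).eval x := fun x hx =>
    (Lagrange.eval_interpolate_at_node (s := hfin.toFinset) (v := id) f
    Function.injective_id.injOn (by simpa using hx)).symm
  generalize Lagrange.interpolate hfin.toFinset id f = p at hp
  have h1 : cfc f (blockSum M) = Polynomial.aeval (blockSum M) p := by
    rw [← cfc_polynomial (R := ℝ) _ _ (blockSum_isHermitian hM).isSelfAdjoint]
    exact cfc_congr fun x hx => hp x (Or.inl hx)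
  have h2 : (fun x => cfc f (M x)) = Polynomial.aeval M p := funext fun x => by
    have : Polynomial.aeval M p x = Polynomial.aeval (M x) p :=
      (Polynomial.aeval_algHom_apply (Pi.evalAlgHom ℝ (fun _ : k => Matrix n n ℂ) x) M p).symm
    rw [this, ← cfc_polynomial (R := ℝ) _ _ (hM x).isSelfAdjoint]
    exact cfc_congr fun y hy => hp y (Or.inr (Set.mem_iUnion.2 ⟨x, hy⟩))
  rw [h1, h2, ← blockSumAlgHom_apply, Polynomial.aeval_algHom_apply, blockSumAlgHom_apply]

theorem entropy_blockSum {k : Type*} [Fintype k] [DecidableEq k] {M : k → Matrix n n ℂ}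
    (hM : ∀ x, (M x).IsHermitian) : entropy (blockSum M) = ∑ x, entropy (M x) := by
  rw [entropy_eq_trace_cfc (blockSum_isHermitian hM), cfc_blockSum hM, trace_blockSum,
    Complex.re_sum]
  exact Finset.sum_congr rfl fun x _ => (entropy_eq_trace_cfc (hM x)).symm

end Entropy

/-! ### Completely positive maps, their adjoints and the Kadison-Schwarz inequality -/

section CompletelyPositive

variable {m n : Type*} [Fintype m] [Fintype n]

omit [Fintype m] [Fintype n] in
theorem idTensor_block (Φ : SuperOp n) (X : Matrix (m × n) (m × n) ℂ) (x y : m) :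
    (Matrix.of fun i j => idTensor m Φ X (x, i) (y, j)) =
      Φ (Matrix.of fun i j => X (x, i) (y, j)) := rfl

theorem IsCompletelyPositive.idTensor_posSemidef {Φ : SuperOp n} (hΦ : IsCompletelyPositive Φ)
    {X : Matrix (m × n) (m × n) ℂ} (hX : X.PosSemidef) : (idTensor m Φ X).PosSemidef := by
  have e := Fintype.equivFin m
  have h := hΦ _ _ (hX.submatrix (Prod.map e.symm id))
  have h2 := h.submatrix (Prod.map e id)
  convert h2 using 1
  ext p q
  simp [idTensor]

theorem IsCompletelyPositive.map_posSemidef {Φ : SuperOp n} (hΦ : IsCompletelyPositive Φ)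
    {X : Matrix n n ℂ} (hX : X.PosSemidef) : (Φ X).PosSemidef :=
  (hΦ.idTensor_posSemidef (m := Unit) (hX.submatrix Prod.snd)).submatrix (Prod.mk ())

theorem IsCompletelyPositive.idTensor {Φ : SuperOp n} (hΦ : IsCompletelyPositive Φ) :
    IsCompletelyPositive (idTensor m Φ) := fun k X hX => by
  have h := hΦ.idTensor_posSemidef (hX.submatrix (Equiv.prodAssoc (Fin k) m n))
  exact h.submatrix (Equiv.prodAssoc (Fin k) m n).symm

variable [DecidableEq n]

/-- The block row `(X, 1)`. -/
def blockRow (X : Matrix n n ℂ) : Matrix n (Bool × n) ℂ :=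
  Matrix.of fun i q => if q.1 then X i q.2 else (1 : Matrix n n ℂ) i q.2

/-- The positive block matrix with rows `(X†X, X†)` and `(X, 1)`. Applying a completely positive map
to its blocks yields both preservation of adjoints and the Kadison-Schwarz inequality. -/
theorem blockRow_gram (X : Matrix n n ℂ) (b c : Bool) :
    (Matrix.of fun i j => ((blockRow X)ᴴ * blockRow X) (b, i) (c, j)) =
      (if b then Xᴴ else 1) * (if c then X else 1) := by
  ext i j
  cases b <;> cases c <;> simp [blockRow, Matrix.mul_apply, Matrix.one_apply]
  simp [eq_comm]

/-- `X†` and `X` are the off-diagonal blocks of a positive matrix whose blockwise image is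
Hermitian. -/
theorem IsCompletelyPositive.map_conjTranspose {Φ : SuperOp n} (hΦ : IsCompletelyPositive Φ)
    (X : Matrix n n ℂ) : Φ Xᴴ = (Φ X)ᴴ := by
  have h := (hΦ.idTensor_posSemidef (posSemidef_conjTranspose_mul_self (blockRow X))).1
  ext i j
  have h1 := h.apply (true, i) (false, j)
  simp only [QDyn.idTensor, LinearMap.coe_mk, AddHom.coe_mk, of_apply, blockRow_gram] at h1
  simpa using h1.symm

theorem hsAdjoint_conjTranspose {Φ : SuperOp n} (hΦ : IsCompletelyPositive Φ)
    (X : Matrix n n ℂ) : hsAdjoint Φ Xᴴ = (hsAdjoint Φ X)ᴴ := by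
  refine Matrix.ext_iff_trace_mul_right.2 fun Y => ?_
  have h := congrArg star (trace_hsAdjoint Φ Yᴴ Xᴴ)
  have h1 := trace_hsAdjoint Φ Y X
  rw [h1]
  simp only [← trace_conjTranspose, conjTranspose_mul, conjTranspose_conjTranspose,
    hΦ.map_conjTranspose] at h
  rw [Matrix.trace_mul_comm, h, Matrix.trace_mul_comm]

theorem trace_hsAdjoint_mul {Φ : SuperOp n} (hΦ : IsCompletelyPositive Φ) (X Y : Matrix n n ℂ) :
    (hsAdjoint Φ X * Y).trace = (X * Φ Y).trace := by
  have h := trace_hsAdjoint Φ Y Xᴴ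
  rwa [hsAdjoint_conjTranspose hΦ, conjTranspose_conjTranspose, conjTranspose_conjTranspose] at h

theorem trace_idTensor_hsAdjoint_mul {Φ : SuperOp n} (hΦ : IsCompletelyPositive Φ)
    (G M : Matrix (m × n) (m × n) ℂ) :
    (idTensor m (hsAdjoint Φ) G * M).trace = (G * idTensor m Φ M).trace := by
  have h : ∀ A B : Matrix (m × n) (m × n) ℂ, (A * B).trace = ∑ x, ∑ y,
      ((Matrix.of fun i j => A (x, i) (y, j)) * (Matrix.of fun i j => B (y, i) (x, j))).trace := by
    intro A B
    simp only [Matrix.trace, Matrix.diag, Matrix.mul_apply, Fintype.sum_prod_type, of_apply]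
    exact Finset.sum_congr rfl fun x _ => Finset.sum_comm
  rw [h, h]
  refine Finset.sum_congr rfl fun x _ => Finset.sum_congr rfl fun y _ => ?_
  rw [idTensor_block, idTensor_block, trace_hsAdjoint_mul hΦ]

/-- By duality: the quadratic form at `ξ` is the trace of `G` against the image of the rank-one
positive matrix `ξ ξ†`. -/
theorem idTensor_hsAdjoint_posSemidef {Φ : SuperOp n} (hΦ : IsCompletelyPositive Φ)
    {G : Matrix (m × n) (m × n) ℂ} (hG : G.PosSemidef) :
    (idTensor m (hsAdjoint Φ) G).PosSemidef := by
  classical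
  refine PosSemidef.of_dotProduct_mulVec_nonneg ?_ fun ξ => ?_
  · ext p q
    have h : ∀ x y, (Matrix.of fun i j => G (x, i) (y, j))ᴴ =
        (Matrix.of fun i j => G (y, i) (x, j)) := fun x y => by
      ext i j
      exact hG.1.apply _ _
    have h1 := congrFun (congrFun (hsAdjoint_conjTranspose hΦ
      (Matrix.of fun i j => G (q.1, i) (p.1, j))) p.2) q.2
    rw [h] at h1
    exact h1.symm
  · have h := trace_mul_nonneg hG (hΦ.idTensor_posSemidef (posSemidef_vecMulVec_self_star ξ))
    rw [← trace_idTensor_hsAdjoint_mul hΦ, mul_vecMulVec, trace_vecMulVec, dotProduct_comm] at h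
    exact h

theorem hsAdjoint_one {Φ : SuperOp n} (hΦ : IsChannel Φ) : hsAdjoint Φ 1 = 1 :=
  Matrix.ext_iff_trace_mul_right.2 fun Y => by
    rw [trace_hsAdjoint_mul hΦ.completelyPositive, Matrix.one_mul, Matrix.one_mul, hΦ.trace_map]

/-- The Kadison-Schwarz inequality. -/
theorem hsAdjoint_schwarz {Φ : SuperOp n} (hΦ : IsChannel Φ) (X : Matrix n n ℂ) :
    (hsAdjoint Φ (Xᴴ * X) - (hsAdjoint Φ X)ᴴ * hsAdjoint Φ X).PosSemidef := by
  have hcp := hΦ.completelyPositive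
  refine PosSemidef.of_dotProduct_mulVec_nonneg ?_ fun v => ?_
  · rw [IsHermitian, conjTranspose_sub, ← hsAdjoint_conjTranspose hcp]
    simp
  · have h := idTensor_hsAdjoint_posSemidef hcp (posSemidef_conjTranspose_mul_self (blockRow X))
    -- Testing against `(v, -Φ^*(X) v)` picks out the Schur complement of the lower right block,
    -- which is `Φ^*(1) = 1`.
    have h1 := h.dotProduct_mulVec_nonneg fun p => if p.1 then v p.2 else -(hsAdjoint Φ X *ᵥ v) p.2
    have h2 : ∀ b c, (Matrix.of fun i j => idTensor Bool (hsAdjoint Φ)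
        ((blockRow X)ᴴ * blockRow X) (b, i) (c, j)) =
        hsAdjoint Φ ((if b then Xᴴ else 1) * (if c then X else 1)) := fun b c => by
      rw [← blockRow_gram, idTensor_block]
    have h3 : ∀ (A : Matrix (Bool × n) (Bool × n) ℂ) (ξ : Bool × n → ℂ),
        star ξ ⬝ᵥ (A *ᵥ ξ) = ∑ b, ∑ c, star (fun i => ξ (b, i)) ⬝ᵥ
          ((Matrix.of fun i j => A (b, i) (c, j)) *ᵥ (fun i => ξ (c, i))) := by
      intro A ξ
      simp only [dotProduct, mulVec, Fintype.sum_prod_type, of_apply, Pi.star_apply, Finset.mul_sum]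
      exact Finset.sum_congr rfl fun b _ => Finset.sum_comm
    rw [h3] at h1
    simp only [h2, Fintype.sum_bool, if_true, Bool.false_eq_true, if_false, Matrix.mul_one,
      Matrix.one_mul, hsAdjoint_one hΦ, one_mulVec, hsAdjoint_conjTranspose hcp] at h1
    have e1 : (fun i => -(hsAdjoint Φ X *ᵥ v) i) = -(hsAdjoint Φ X *ᵥ v) := rfl
    have e2 : (fun i => v i) = v := rfl
    rw [e1, e2] at h1
    rw [sub_mulVec, dotProduct_sub, ← mulVec_mulVec]
    simp only [mulVec_neg, dotProduct_neg, star_neg, neg_dotProduct, neg_neg, neg_add_cancel,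
      add_zero] at h1
    rw [sub_eq_add_neg]
    exact h1

end CompletelyPositive

/-! ### Idempotent channels with a faithful invariant state -/

section FaithfulIdempotent

variable {n : Type*} [Fintype n] [DecidableEq n]

/-- An idempotent channel with a faithful invariant state (up to normalization). -/
structure IsFaithfulIdempotent (P : SuperOp n) : Prop where
  channel : IsChannel P
  idem : ∀ X, P (P X) = P X
  exists_posDef : ∃ σ : Matrix n n ℂ, σ.PosDef ∧ P σ = σ

theorem eq_zero_of_trace_posDef_mul {σ A : Matrix n n ℂ} (hσ : σ.PosDef) (hA : A.PosSemidef)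
    (h : (σ * A).trace = 0) : A = 0 := by
  have h1 := mul_eq_zero_of_trace_mul_eq_zero hσ.posSemidef hA h
  have h2 := Matrix.nonsing_inv_mul_cancel_left σ A
    ((Matrix.isUnit_iff_isUnit_det _).1 hσ.isUnit)
  rw [← h2, h1, Matrix.mul_zero]

theorem eq_zero_of_dotProduct_mulVec_self {D : Matrix n n ℂ}
    (h : ∀ v, star v ⬝ᵥ (D *ᵥ v) = 0) : D = 0 := by
  have h1 : Matrix.toEuclideanLin D = 0 := by
    rw [← inner_map_self_eq_zero]
    intro x
    rw [← inner_conj_symm, EuclideanSpace.inner_eq_star_dotProduct, dotProduct_comm]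
    simpa using h x.ofLp
  simpa using h1

namespace IsFaithfulIdempotent

variable {P : SuperOp n} (hP : IsFaithfulIdempotent P)
include hP

theorem trace_hsAdjoint (X Y : Matrix n n ℂ) : (hsAdjoint P X * Y).trace = (X * P Y).trace :=
  trace_hsAdjoint_mul hP.channel.completelyPositive X Y

theorem hsAdjoint_star (X : Matrix n n ℂ) : hsAdjoint P Xᴴ = (hsAdjoint P X)ᴴ :=
  hsAdjoint_conjTranspose hP.channel.completelyPositive X

theorem hsAdjoint_idem (X : Matrix n n ℂ) : hsAdjoint P (hsAdjoint P X) = hsAdjoint P X :=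
  Matrix.ext_iff_trace_mul_right.2 fun Y => by
    rw [hP.trace_hsAdjoint, hP.trace_hsAdjoint, hP.trace_hsAdjoint, hP.idem]

/-- The Kadison-Schwarz defect of a fixed point is positive and has zero expectation in the faithful
invariant `σ`, so it vanishes. -/
theorem hsAdjoint_gram {X : Matrix n n ℂ} (hX : hsAdjoint P X = X) :
    hsAdjoint P (Xᴴ * X) = Xᴴ * X := by
  obtain ⟨σ, hσ, hPσ⟩ := hP.exists_posDef
  have h := hsAdjoint_schwarz hP.channel X
  rw [hX] at h
  refine sub_eq_zero.1 (eq_zero_of_trace_posDef_mul hσ h ?_)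
  rw [Matrix.trace_mul_comm, Matrix.sub_mul, Matrix.trace_sub, hP.trace_hsAdjoint, hPσ, sub_self]

/-- A fixed point of the adjoint lies in its multiplicative domain. -/
theorem hsAdjoint_conjTranspose_mul {X : Matrix n n ℂ} (hX : hsAdjoint P X = X)
    (Y : Matrix n n ℂ) : hsAdjoint P (Xᴴ * Y) = Xᴴ * hsAdjoint P Y := by
  set D := hsAdjoint P (Xᴴ * Y) - Xᴴ * hsAdjoint P Y with hD
  refine sub_eq_zero.1 (eq_zero_of_dotProduct_mulVec_self fun v => ?_)
  rw [← hD]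
  set b := star v ⬝ᵥ (D *ᵥ v) with hb
  set A := hsAdjoint P (Yᴴ * Y) - (hsAdjoint P Y)ᴴ * hsAdjoint P Y with hA
  have hb' : star v ⬝ᵥ (Dᴴ *ᵥ v) = star b := by
    rw [hb, star_dotProduct, star_mulVec, dotProduct_mulVec, conjTranspose_conjTranspose]
  -- In the Kadison-Schwarz inequality for `Y + c X` the `|c|²` terms cancel by `hsAdjoint_gram`.
  -- What remains is real affine in `c` and nonnegative for every `c`, which forces `b = 0`.
  have key : ∀ c : ℂ, 0 ≤ star v ⬝ᵥ (A *ᵥ v) + (star c * b + c * star b) := fun c => by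
    have h := (hsAdjoint_schwarz hP.channel (Y + c • X)).dotProduct_mulVec_nonneg v
    have e : hsAdjoint P ((Y + c • X)ᴴ * (Y + c • X)) -
        (hsAdjoint P (Y + c • X))ᴴ * hsAdjoint P (Y + c • X) = A + (star c • D + c • Dᴴ) := by
      have e1 : hsAdjoint P (Yᴴ * X) = (hsAdjoint P (Xᴴ * Y))ᴴ := by
        rw [← hP.hsAdjoint_star, conjTranspose_mul, conjTranspose_conjTranspose]
      simp only [hA, hD, conjTranspose_add, conjTranspose_smul, Matrix.add_mul, Matrix.mul_add,
        Matrix.smul_mul, Matrix.mul_smul, map_add, map_smul, hX, hP.hsAdjoint_gram hX, e1,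
        conjTranspose_sub, conjTranspose_mul, conjTranspose_conjTranspose, smul_sub, smul_add]
      abel
    rw [e, add_mulVec, add_mulVec, smul_mulVec, smul_mulVec, dotProduct_add, dotProduct_add,
      dotProduct_smul, dotProduct_smul, ← hb, hb'] at h
    simpa using h
  by_contra hb0
  have hn : 0 < ‖b‖ ^ 2 := by positivity
  have ha := key 0
  -- With `a` the constant term, this `c` makes the expression equal to `a - 2 (a + 1) < 0`.
  have h := key (-(((star v ⬝ᵥ (A *ᵥ v)).re + 1) / ‖b‖ ^ 2 : ℝ) * b)
  generalize star v ⬝ᵥ (A *ᵥ v) = a at h ha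
  have h2 := (Complex.le_def.1 h).1
  have e : star (-(((a.re + 1) / ‖b‖ ^ 2 : ℝ) : ℂ) * b) * b + -(((a.re + 1) / ‖b‖ ^ 2 : ℝ) : ℂ) * b * star b
      = ((-(2 * (a.re + 1)) : ℝ) : ℂ) := by
    have e2 : b * star b = ((‖b‖ ^ 2 : ℝ) : ℂ) := by simpa using Complex.mul_conj' b
    have e3 : star (-(((a.re + 1) / ‖b‖ ^ 2 : ℝ) : ℂ) * b) = -(((a.re + 1) / ‖b‖ ^ 2 : ℝ) : ℂ) * star b := by
      simp
    rw [e3, mul_assoc, mul_comm (star b), mul_assoc, e2, ← Complex.ofReal_neg, ← Complex.ofReal_mul,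
      ← Complex.ofReal_add]
    congr 1
    field_simp
    ring
  rw [e, Complex.add_re, Complex.ofReal_re, Complex.zero_re] at h2
  simp only [zero_mul, star_zero, add_zero] at ha
  have ha2 := (Complex.le_def.1 ha).1
  rw [Complex.zero_re] at ha2
  linarith

theorem hsAdjoint_mul_left {X : Matrix n n ℂ} (hX : hsAdjoint P X = X) (Y : Matrix n n ℂ) :
    hsAdjoint P (X * Y) = X * hsAdjoint P Y := by
  have h := hP.hsAdjoint_conjTranspose_mul (X := Xᴴ) (by rw [hP.hsAdjoint_star, hX]) Y
  rwa [conjTranspose_conjTranspose] at h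

theorem hsAdjoint_mul_right {X : Matrix n n ℂ} (hX : hsAdjoint P X = X) (Y : Matrix n n ℂ) :
    hsAdjoint P (Y * X) = hsAdjoint P Y * X := by
  have h := congrArg conjTranspose (hP.hsAdjoint_conjTranspose_mul hX Yᴴ)
  rwa [← hP.hsAdjoint_star, conjTranspose_mul, conjTranspose_mul, ← hP.hsAdjoint_star,
    conjTranspose_conjTranspose, conjTranspose_conjTranspose] at h

theorem trace_mul_map_one (X : Matrix n n ℂ) : (X * P 1).trace = (hsAdjoint P X).trace := by
  rw [← hP.trace_hsAdjoint, Matrix.mul_one]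

/-- The functional `tr(· P(1)) = tr P^*(·)` takes equal values on `X Y` and `Y X` when `X` is a
fixed point, by the bimodule property and cyclicity of the trace. -/
theorem map_one_mul_comm {X : Matrix n n ℂ} (hX : hsAdjoint P X = X) : P 1 * X = X * P 1 :=
  Matrix.ext_iff_trace_mul_right.2 fun Y => by
    rw [Matrix.mul_assoc, Matrix.trace_mul_comm, hP.trace_mul_map_one, hP.hsAdjoint_mul_left hX,
      Matrix.mul_assoc, Matrix.trace_mul_comm X (P 1 * Y), Matrix.mul_assoc,
      Matrix.trace_mul_comm (P 1), hP.trace_mul_map_one, hP.hsAdjoint_mul_right hX,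
      Matrix.trace_mul_comm]

theorem map_mul_map_one (Y : Matrix n n ℂ) : P (Y * P 1) = hsAdjoint P Y * P 1 :=
  Matrix.ext_iff_trace_mul_left.2 fun X => by
    rw [← hP.trace_hsAdjoint, ← Matrix.mul_assoc, hP.trace_mul_map_one, ← Matrix.mul_assoc,
      hP.trace_mul_map_one, hP.hsAdjoint_mul_left (hP.hsAdjoint_idem X),
      hP.hsAdjoint_mul_right (hP.hsAdjoint_idem Y)]

theorem hsAdjoint_posSemidef {A : Matrix n n ℂ} (hA : A.PosSemidef) :
    (hsAdjoint P A).PosSemidef :=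
  (idTensor_hsAdjoint_posSemidef (m := Unit) hP.channel.completelyPositive
    (hA.submatrix Prod.snd)).submatrix (Prod.mk ())

/-- If `⟨v, P(1) v⟩ = 0`, then `P^*(v v†)` is positive with trace zero, hence zero, so `v v†` has
zero expectation in the faithful invariant `σ`. -/
theorem map_one_posDef : (P 1).PosDef := by
  have h1 := hP.channel.completelyPositive.map_posSemidef (PosSemidef.one (n := n) (R := ℂ))
  refine PosDef.of_dotProduct_mulVec_pos h1.1 fun v hv => ?_
  refine lt_of_le_of_ne (h1.dotProduct_mulVec_nonneg v) fun h0 => hv ?_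
  have hA := posSemidef_vecMulVec_self_star v
  have h2 : (vecMulVec v (star v) * P 1).trace = 0 := by
    rw [Matrix.trace_mul_comm, mul_vecMulVec, trace_vecMulVec, dotProduct_comm, ← h0]
  rw [hP.trace_mul_map_one, (hP.hsAdjoint_posSemidef hA).trace_eq_zero_iff] at h2
  obtain ⟨σ, hσ, hPσ⟩ := hP.exists_posDef
  have h3 := eq_zero_of_trace_posDef_mul hσ hA (by
    rw [Matrix.trace_mul_comm, ← hPσ, ← hP.trace_hsAdjoint, h2, Matrix.zero_mul,
      Matrix.trace_zero])
  have h4 := congrArg Matrix.trace h3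
  rw [trace_vecMulVec, Matrix.trace_zero] at h4
  exact dotProduct_self_star_eq_zero.1 h4

theorem hsAdjoint_cfc {Y : Matrix n n ℂ} (hY : Y.IsHermitian) (hfix : hsAdjoint P Y = Y)
    (f : ℝ → ℝ) : hsAdjoint P (cfc f Y) = cfc f Y := by
  obtain ⟨p, hp⟩ := exists_cfc_eq_aeval hY f
  rw [hp]
  have hpow : ∀ k : ℕ, hsAdjoint P (Y ^ k) = Y ^ k := fun k => by
    induction k with
    | zero => rw [pow_zero, hsAdjoint_one hP.channel]
    | succ k ih => rw [pow_succ, hP.hsAdjoint_mul_left ih, hfix]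
  rw [Polynomial.aeval_eq_sum_range, map_sum]
  refine Finset.sum_congr rfl fun i _ => ?_
  have : ∀ (r : ℝ) (A : Matrix n n ℂ), r • A = (r : ℂ) • A := fun r A => rfl
  rw [this, map_smul, hpow]

end IsFaithfulIdempotent

/-- The support projection. -/
def supportProj (Y : Matrix n n ℂ) : Matrix n n ℂ := cfc (fun x : ℝ => if x = 0 then 0 else 1) Y

/-- The logarithm of a commuting product. -/
theorem mlog_mul_of_commute {Y T : Matrix n n ℂ} (hY : Y.IsHermitian) (hT : T.PosDef)
    (hc : Y * T = T * Y) : mlog (Y * T) = mlog Y + supportProj Y * mlog T := by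
  have hZ : (Y * T).IsHermitian := by
    rw [IsHermitian, conjTranspose_mul, hY.eq, hT.1.eq, hc]
  have hYs := isSymmetric_toEuclideanLin_iff.2 hY
  have hTs := isSymmetric_toEuclideanLin_iff.2 hT.1
  have hcomm : Commute (toEuclideanLin Y) (toEuclideanLin T) := by
    refine LinearMap.ext fun x => ?_
    simp [toLpLin_apply, hc]
  -- Commuting Hermitian matrices have joint eigenvectors that span, so the identity can be checked
  -- on these.
  have htop := LinearMap.IsSymmetric.iSup_iSup_eigenspace_inf_eigenspace_eq_top_of_commute
    hYs hTs hcomm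
  set M := mlog (Y * T) - (mlog Y + supportProj Y * mlog T) with hM
  suffices h : LinearMap.ker (toEuclideanLin M) = ⊤ by
    rw [LinearMap.ker_eq_top] at h
    exact sub_eq_zero.1 (by simpa using h)
  rw [eq_top_iff, ← htop]
  refine iSup_le fun α => iSup_le fun γ => ?_
  rintro x ⟨hx1, hx2⟩
  by_cases hx : x = 0
  · rw [hx]; exact zero_mem _
  have hα := hYs.conj_eigenvalue_eq_self (Module.End.hasEigenvalue_of_hasEigenvector ⟨hx1, hx⟩)
  have hγ := hTs.conj_eigenvalue_eq_self (Module.End.hasEigenvalue_of_hasEigenvector ⟨hx2, hx⟩)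
  obtain ⟨a, rfl⟩ : ∃ a : ℝ, (a : ℂ) = α := ⟨α.re, Complex.conj_eq_iff_re.1 hα⟩
  obtain ⟨c, rfl⟩ : ∃ c : ℝ, (c : ℂ) = γ := ⟨γ.re, Complex.conj_eq_iff_re.1 hγ⟩
  have hYx : Y *ᵥ x.ofLp = (a : ℂ) • x.ofLp := congrArg WithLp.ofLp (Module.End.mem_eigenspace_iff.1 hx1)
  have hTx : T *ᵥ x.ofLp = (c : ℂ) • x.ofLp := congrArg WithLp.ofLp (Module.End.mem_eigenspace_iff.1 hx2)
  have hx' : x.ofLp ≠ 0 := fun h => hx (by ext i; simp [h])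
  have hZx : (Y * T) *ᵥ x.ofLp = ((a * c : ℝ) : ℂ) • x.ofLp := by
    rw [← mulVec_mulVec, hTx, mulVec_smul, hYx, smul_smul, Complex.ofReal_mul, mul_comm]
  have hc0 : c ≠ 0 := by
    rintro rfl
    have := hT.dotProduct_mulVec_pos hx'
    rw [hTx] at this
    simp at this
  have key : M *ᵥ x.ofLp = 0 := by
    rw [hM, sub_mulVec, add_mulVec, mlog, mlog, mlog, supportProj,
      cfc_mulVec_of_eigenvector hZ _ hZx, cfc_mulVec_of_eigenvector hY _ hYx, ← mulVec_mulVec,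
      cfc_mulVec_of_eigenvector hT.1 _ hTx, mulVec_smul, cfc_mulVec_of_eigenvector hY _ hYx]
    -- On the kernel of `Y` the convention `log 0 = 0` annihilates both logarithms, and the support
    -- projection removes the contribution of `log T`.
    by_cases ha : a = 0
    · simp [ha]
    · rw [Real.log_mul ha hc0, if_neg ha, smul_smul, ← add_smul, ← sub_smul]
      simp
  rw [LinearMap.mem_ker]
  exact congrArg (WithLp.toLp 2) key

namespace IsFaithfulIdempotent

variable {P : SuperOp n} (hP : IsFaithfulIdempotent P)
include hP

/-- An element of the range is `Y * P 1` with `Y` a Hermitian fixed point of the adjoint. -/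
theorem exists_eq_mul_map_one {ω : Matrix n n ℂ} (hω : ω.IsHermitian) :
    ∃ Y : Matrix n n ℂ, Y.IsHermitian ∧ hsAdjoint P Y = Y ∧ P ω = Y * P 1 := by
  have hT := hP.map_one_posDef
  have hu := (Matrix.isUnit_iff_isUnit_det _).1 hT.isUnit
  have hYT : P ω * (P 1)⁻¹ * P 1 = P ω := Matrix.nonsing_inv_mul_cancel_right _ _ hu
  -- `P ω` is fixed by `P`, and `P (Y * P 1) = P^*(Y) * P 1`; cancelling the invertible `P 1` shows
  -- that `Y` is a fixed point of the adjoint.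
  have hfix : hsAdjoint P (P ω * (P 1)⁻¹) = P ω * (P 1)⁻¹ := by
    have h := hP.map_mul_map_one (P ω * (P 1)⁻¹)
    rw [hYT, hP.idem] at h
    conv_rhs => rw [h, Matrix.mul_nonsing_inv_cancel_right _ _ hu]
  refine ⟨_, ?_, hfix, hYT.symm⟩
  have h1 := congrArg conjTranspose hYT
  rw [conjTranspose_mul, hT.1.eq, ← hP.channel.completelyPositive.map_conjTranspose ω, hω.eq] at h1
  have h2 := hP.map_one_mul_comm hfix
  rw [hYT] at h2
  have h3 := congrArg (fun X => (P 1)⁻¹ * X) (h1.trans h2.symm)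
  simp only [Matrix.nonsing_inv_mul_cancel_left _ _ hu] at h3
  exact h3

/-- With `q` the support projection of `Y`, `1 - q` is again a fixed point of the adjoint. Thus `tr
ω(1 - q) = tr P(ω)(1 - q) = 0`, and positivity gives `ω (1 - q) = 0`. -/
theorem supports {ω : Matrix n n ℂ} (hω : ω.PosSemidef) {Y : Matrix n n ℂ} (hY : Y.IsHermitian)
    (hfix : hsAdjoint P Y = Y) (hYT : P ω = Y * P 1) :
    ω * supportProj Y = ω ∧ P ω * supportProj Y = P ω := by
  have hs : supportProj Y * Y = Y := by
    rw [supportProj]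
    nth_rewrite 2 [← cfc_id' ℝ Y hY.isSelfAdjoint]
    rw [← cfc_mul _ _ Y (continuousOn_spectrum _ _) (continuousOn_spectrum _ _)]
    conv_rhs => rw [← cfc_id' ℝ Y hY.isSelfAdjoint]
    refine cfc_congr fun x _ => ?_
    by_cases h : x = 0 <;> simp [h]
  have hZ : P ω * supportProj Y = P ω := by
    have e : Y * supportProj Y = Y := by
      have := congrArg conjTranspose hs
      have hsa : (supportProj Y)ᴴ = supportProj Y := cfc_predicate (R := ℝ) _ Y
      rwa [conjTranspose_mul, hY.eq, hsa] at this
    rw [hYT, ← hP.map_one_mul_comm hfix, Matrix.mul_assoc, e]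
  refine ⟨?_, hZ⟩
  have hq : (1 - supportProj Y).PosSemidef := by
    have hsa : (supportProj Y)ᴴ = supportProj Y := cfc_predicate (R := ℝ) _ Y
    have hss : supportProj Y * supportProj Y = supportProj Y := by
      rw [supportProj, ← cfc_mul _ _ Y (continuousOn_spectrum _ _) (continuousOn_spectrum _ _)]
      refine cfc_congr fun x _ => ?_
      by_cases h : x = 0 <;> simp [h]
    have : 1 - supportProj Y = (1 - supportProj Y)ᴴ * (1 - supportProj Y) := by
      rw [conjTranspose_sub, conjTranspose_one, hsa, Matrix.sub_mul, Matrix.mul_sub,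
        Matrix.mul_sub, hss]
      simp
    rw [this]
    exact posSemidef_conjTranspose_mul_self _
  have h := mul_eq_zero_of_trace_mul_eq_zero hω hq (by
    have e : hsAdjoint P (1 - supportProj Y) = 1 - supportProj Y := by
      rw [map_sub, hsAdjoint_one hP.channel, supportProj, hP.hsAdjoint_cfc hY hfix]
    rw [Matrix.trace_mul_comm, ← e, hP.trace_hsAdjoint, Matrix.trace_mul_comm, Matrix.mul_sub, hZ]
    simp)
  rw [Matrix.mul_sub, Matrix.mul_one, sub_eq_zero] at h
  exact h.symm

/-- Makes `D(ω‖P ω)` finite, so that `relEntropy` may be replaced by `realRelEntropy`. -/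
theorem ker_le {ω : Matrix n n ℂ} (hω : ω.PosSemidef) (v : n → ℂ) (hv : P ω *ᵥ v = 0) :
    ω *ᵥ v = 0 := by
  obtain ⟨Y, hY, hfix, hYT⟩ := hP.exists_eq_mul_map_one hω.1
  have hu := (Matrix.isUnit_iff_isUnit_det _).1 hP.map_one_posDef.isUnit
  rw [hYT, ← hP.map_one_mul_comm hfix] at hv
  have h1 : Y *ᵥ v = ((0 : ℝ) : ℂ) • v := by
    have := congrArg (fun w => (P 1)⁻¹ *ᵥ w) hv
    simpa [mulVec_mulVec, Matrix.nonsing_inv_mul_cancel_left _ _ hu] using this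
  have h2 : supportProj Y *ᵥ v = 0 := by
    rw [supportProj, cfc_mulVec_of_eigenvector hY _ h1]
    simp
  rw [← (hP.supports hω hY hfix hYT).1, ← mulVec_mulVec, h2, mulVec_zero]

/-- In `log P(ω) = log Y + supp(Y) log P(1)`, the fixed point `log Y` has the same trace against `ω`
as against `P ω`, and the support projection is absorbed by both. -/
theorem trace_mul_mlog_map {ω : Matrix n n ℂ} (hω : ω.PosSemidef) :
    (ω * mlog (P ω)).trace = (P ω * mlog (P ω)).trace + ((ω - P ω) * mlog (P 1)).trace := by
  obtain ⟨Y, hY, hfix, hYT⟩ := hP.exists_eq_mul_map_one hω.1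
  obtain ⟨h1, h2⟩ := hP.supports hω hY hfix hYT
  have hlog : mlog (P ω) = mlog Y + supportProj Y * mlog (P 1) := by
    rw [hYT, mlog_mul_of_commute hY hP.map_one_posDef (hP.map_one_mul_comm hfix).symm]
  have h3 : (ω * mlog Y).trace = (P ω * mlog Y).trace := by
    rw [Matrix.trace_mul_comm, mlog, ← hP.hsAdjoint_cfc hY hfix, hP.trace_hsAdjoint,
      Matrix.trace_mul_comm, hP.hsAdjoint_cfc hY hfix]
  rw [hlog, Matrix.mul_add, Matrix.mul_add, ← Matrix.mul_assoc, ← Matrix.mul_assoc, h1, h2,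
    Matrix.trace_add, Matrix.trace_add, h3, Matrix.sub_mul, Matrix.trace_sub]
  ring

theorem realRelEntropy_map {ω : Matrix n n ℂ} (hω : ω.PosSemidef) :
    realRelEntropy ω (P ω) =
      entropy (P ω) - entropy ω - ((ω - P ω) * mlog (P 1)).trace.re := by
  rw [realRelEntropy_eq, hP.trace_mul_mlog_map hω, entropy, entropy, Complex.add_re]
  ring

end IsFaithfulIdempotent

end FaithfulIdempotent

/-! ### Comparing the information quantities of `Ψ` and `P` when `P Ψ = P` -/

section Comparison

variable {m n : Type*} [Fintype m] [Fintype n]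

omit [Fintype n] in
theorem marginalSnd_idTensor (Φ : SuperOp n) (ω : Matrix (m × n) (m × n) ℂ) :
    marginalSnd (idTensor m Φ ω) = Φ (marginalSnd ω) := by
  have h : ∀ A : Matrix (m × n) (m × n) ℂ,
      marginalSnd A = ∑ x, Matrix.of fun i j => A (x, i) (x, j) := fun A => by
    ext i j
    simp [marginalSnd, Matrix.sum_apply]
  rw [h, h, map_sum]
  exact Finset.sum_congr rfl fun x _ => idTensor_block Φ ω x x

omit [Fintype m] in
theorem marginalFst_idTensor {Φ : SuperOp n} (hΦ : IsChannel Φ) (ω : Matrix (m × n) (m × n) ℂ) :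
    marginalFst (idTensor m Φ ω) = marginalFst ω := by
  ext x y
  exact hΦ.trace_map (Matrix.of fun i j => ω (x, i) (y, j))

theorem trace_marginalSnd (ω : Matrix (m × n) (m × n) ℂ) :
    (marginalSnd ω).trace = ω.trace := by
  simp [Matrix.trace, marginalSnd, Fintype.sum_prod_type, Finset.sum_comm (s := (Finset.univ : Finset m))]

theorem IsChannel.idTensor {Φ : SuperOp n} (hΦ : IsChannel Φ) : IsChannel (idTensor m Φ) where
  completelyPositive := hΦ.completelyPositive.idTensor
  trace_map X := by
    rw [← trace_marginalSnd, marginalSnd_idTensor, hΦ.trace_map, trace_marginalSnd]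

theorem IsState.map {Φ : SuperOp n} (hΦ : IsChannel Φ) {ρ : Matrix n n ℂ} (hρ : IsState ρ) :
    IsState (Φ ρ) :=
  ⟨hΦ.completelyPositive.map_posSemidef hρ.1, by rw [hΦ.trace_map, hρ.2]⟩

omit [Fintype n] in
theorem marginalSnd_posSemidef {ω : Matrix (m × n) (m × n) ℂ} (hω : ω.PosSemidef) :
    (marginalSnd ω).PosSemidef := by
  have h : marginalSnd ω = ∑ x, ω.submatrix (Prod.mk x) (Prod.mk x) := by
    ext i j
    simp [marginalSnd, Matrix.sum_apply]
  rw [h]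
  exact posSemidef_sum _ fun x _ => hω.submatrix _

omit [Fintype m] [Fintype n] in
theorem idTensor_idTensor_apply (Φ Ψ : SuperOp n) (X : Matrix (m × n) (m × n) ℂ) :
    idTensor m (Φ * Ψ) X = idTensor m Φ (idTensor m Ψ X) := rfl

variable [DecidableEq m] [DecidableEq n]

omit [Fintype m] [Fintype n] [DecidableEq n] in
theorem idTensor_blockSum (Φ : SuperOp n) (M : m → Matrix n n ℂ) :
    idTensor m Φ (blockSum M) = blockSum fun x => Φ (M x) := by
  have h : ∀ (N : m → Matrix n n ℂ) (x y : m), (Matrix.of fun i j => blockSum N (x, i) (y, j)) =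
      if x = y then N x else 0 := fun N x y => by
    ext i j
    by_cases h : x = y <;> simp [blockSum, h]
  ext ⟨x, i⟩ ⟨y, j⟩
  have h1 := idTensor_block Φ (blockSum M) x y
  have h2 := h (fun x => Φ (M x)) x y
  rw [h] at h1
  refine (congrFun (congrFun h1 i) j).trans (Eq.trans ?_ (congrFun (congrFun h2 i) j).symm)
  by_cases hxy : x = y <;> simp [hxy]

theorem blockSum_one : blockSum (fun _ : m => (1 : Matrix n n ℂ)) = 1 := by
  rw [← blockSumAlgHom_apply]
  exact map_one _

omit [DecidableEq n] in
theorem trace_mul_blockSum_const (ω : Matrix (m × n) (m × n) ℂ) (B : Matrix n n ℂ) :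
    (ω * blockSum fun _ => B).trace = (marginalSnd ω * B).trace := by
  simp only [Matrix.trace, Matrix.diag, Matrix.mul_apply, Fintype.sum_prod_type, blockSum,
    of_apply, marginalSnd, Finset.sum_mul]
  rw [Finset.sum_comm]
  refine Finset.sum_congr rfl fun i _ => ?_
  rw [Finset.sum_comm]
  refine (Finset.sum_congr rfl fun x _ => ?_).trans Finset.sum_comm
  rw [Finset.sum_eq_single x (fun y _ hy => by simp [hy.symm]) (by simp)]
  simp

omit [DecidableEq n] in
theorem IsFaithfulIdempotent.idTensor {P : SuperOp n} (hP : IsFaithfulIdempotent P) :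
    IsFaithfulIdempotent (idTensor m P) where
  channel := hP.channel.idTensor
  idem X := by
    rw [← idTensor_idTensor_apply]
    congr 1
    exact congrArg (QDyn.idTensor m) (LinearMap.ext hP.idem)
  exists_posDef := by
    obtain ⟨σ, hσ, h⟩ := hP.exists_posDef
    exact ⟨_, (PosDef.one (n := m) (R := ℂ)).kronecker hσ, by rw [idTensor_kronecker, h]⟩

variable {P Ψ : SuperOp n} (hP : IsFaithfulIdempotent P) (hΨ : IsChannel Ψ)
  (hPΨ : ∀ X, P (Ψ X) = P X)
include hP hΨ hPΨ

/-- As `P Ψ = P`, this concerns `D(ω‖P ω)` for `ω = Ψ ρ`, and Klein's inequality applies to two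
matrices of equal trace. -/
theorem realRelEntropy_map_nonneg {ρ : Matrix n n ℂ} (hρ : ρ.PosSemidef) :
    0 ≤ realRelEntropy (Ψ ρ) (P ρ) := by
  have h1 := hΨ.completelyPositive.map_posSemidef hρ
  have h := sub_le_realRelEntropy h1 (hP.channel.completelyPositive.map_posSemidef h1)
    (hP.ker_le h1)
  rwa [hP.channel.trace_map, sub_self, hPΨ] at h

theorem realRelEntropy_comp {ρ : Matrix n n ℂ} (hρ : ρ.PosSemidef) :
    realRelEntropy (Ψ ρ) (P ρ) =
      entropy (P ρ) - entropy (Ψ ρ) - ((Ψ ρ - P ρ) * mlog (P 1)).trace.re := by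
  have h := hP.realRelEntropy_map (hΨ.completelyPositive.map_posSemidef hρ)
  rwa [hPΨ] at h

/-- The logarithm of `(id ⊗ P)(1)` is `1 ⊗ log P(1)`, so the correction term sees only the marginal
on the second factor. -/
theorem realRelEntropy_idTensor {ω : Matrix (m × n) (m × n) ℂ} (hω : ω.PosSemidef) :
    realRelEntropy (idTensor m Ψ ω) (idTensor m P ω) =
      entropy (idTensor m P ω) - entropy (idTensor m Ψ ω) -
        ((Ψ (marginalSnd ω) - P (marginalSnd ω)) * mlog (P 1)).trace.re := by
  have hPΨ' : ∀ X, idTensor m P (idTensor m Ψ X) = idTensor m P X := fun X => by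
    rw [← idTensor_idTensor_apply]
    exact congrArg (fun A => QDyn.idTensor m A X) (LinearMap.ext hPΨ)
  have h1 : mlog (idTensor m P 1) = blockSum fun _ => mlog (P 1) := by
    rw [← blockSum_one, idTensor_blockSum, mlog, cfc_blockSum fun _ => hP.map_one_posDef.1]
    rfl
  rw [realRelEntropy_comp hP.idTensor hΨ.idTensor hPΨ' hω, h1, Matrix.sub_mul, Matrix.trace_sub,
    trace_mul_blockSum_const, trace_mul_blockSum_const, marginalSnd_idTensor,
    marginalSnd_idTensor, ← Matrix.trace_sub, ← Matrix.sub_mul]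

/-- The two sides differ by exactly the relative entropy of the marginals, which carries the same
correction term and is nonnegative. -/
theorem coherentInfo_sub_le {ω : Matrix (m × n) (m × n) ℂ} (hω : ω.PosSemidef) :
    coherentInfo (idTensor m Ψ ω) - coherentInfo (idTensor m P ω) ≤
      realRelEntropy (idTensor m Ψ ω) (idTensor m P ω) := by
  have h1 := realRelEntropy_map_nonneg hP hΨ hPΨ (marginalSnd_posSemidef hω)
  rw [realRelEntropy_comp hP hΨ hPΨ (marginalSnd_posSemidef hω)] at h1
  rw [realRelEntropy_idTensor hP hΨ hPΨ hω, coherentInfo, coherentInfo, marginalSnd_idTensor,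
    marginalSnd_idTensor]
  linarith

theorem channelCoherentInfo_sub_le {R : EReal}
    (hR : ∀ ω : Matrix (n × n) (n × n) ℂ, IsState ω →
      (realRelEntropy (idTensor n Ψ ω) (idTensor n P ω) : EReal) ≤ R) :
    channelCoherentInfo Ψ - channelCoherentInfo P ≤ R := by
  refine EReal.sub_le_of_le_add (sSup_le ?_)
  rintro r ⟨ω, hω, rfl⟩
  have h := coherentInfo_sub_le hP hΨ hPΨ hω.1
  calc (coherentInfo (idTensor n Ψ ω) : EReal) ≤
      ((realRelEntropy (idTensor n Ψ ω) (idTensor n P ω) + coherentInfo (idTensor n P ω) : ℝ) :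
        EReal) := by exact_mod_cast (by linarith)
    _ ≤ _ := by
      rw [EReal.coe_add]
      exact add_le_add (hR ω hω) (le_sSup ⟨ω, hω, rfl⟩)

omit [Fintype n] [DecidableEq n] hP hΨ hPΨ in
theorem cqState_eq_blockSum {k : ℕ} (p : Fin k → ℝ) (ρ : Fin k → Matrix n n ℂ) :
    cqState p ρ = blockSum fun x => (p x : ℂ) • ρ x := by
  ext ⟨x, i⟩ ⟨y, j⟩
  simp only [cqState, Matrix.sum_apply, blockSum, Matrix.smul_apply, of_apply,
    Matrix.kroneckerMap_apply, Matrix.single_apply]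
  rw [Finset.sum_eq_single x]
  · by_cases h : x = y <;> simp [h]
  · intro z _ hz
    simp [hz]
  · simp

omit [Fintype n] [DecidableEq n] hP hΨ hPΨ in
theorem marginalSnd_blockSum (M : m → Matrix n n ℂ) : marginalSnd (blockSum M) = ∑ x, M x := by
  ext i j
  simp [marginalSnd, blockSum, Matrix.sum_apply]

open scoped Kronecker in
omit [DecidableEq n] hP hΨ hPΨ in
theorem cqState_posSemidef {k : ℕ} {p : Fin k → ℝ} {ρ : Fin k → Matrix n n ℂ}
    (hp : ∀ x, 0 ≤ p x) (hρ : ∀ x, (ρ x).PosSemidef) : (cqState p ρ).PosSemidef := by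
  have h : cqState p ρ = ∑ x, (p x : ℂ) • (Matrix.single x x (1 : ℂ) ⊗ₖ ρ x) := rfl
  rw [h]
  refine posSemidef_sum _ fun x _ => posSemidef_ofReal_smul (PosSemidef.kronecker ?_ (hρ x)) (hp x)
  have h1 : Matrix.single x x (1 : ℂ) = vecMulVec (Pi.single x 1) (star (Pi.single x 1)) := by
    ext i j
    by_cases hi : i = x <;> by_cases hj : j = x <;>
      simp [vecMulVec_apply, hi, hj, eq_comm (a := x)]
  rw [h1]
  exact posSemidef_vecMulVec_self_star _

/-- The Shannon terms `negMulLog (p x)` are the same for both channels and cancel. -/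
theorem realRelEntropy_idTensor_cqState {k : ℕ} {p : Fin k → ℝ} {ρ : Fin k → Matrix n n ℂ}
    (hp : ∀ x, 0 ≤ p x) (hρ : ∀ x, IsState (ρ x)) :
    realRelEntropy (idTensor (Fin k) Ψ (cqState p ρ)) (idTensor (Fin k) P (cqState p ρ)) =
      ∑ x, p x * realRelEntropy (Ψ (ρ x)) (P (ρ x)) := by
  have hω : (cqState p ρ).PosSemidef := cqState_posSemidef hp fun x => (hρ x).1
  have hherm : ∀ {Φ : SuperOp n}, IsChannel Φ → ∀ x, (Φ (ρ x)).IsHermitian := fun hΦ x =>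
    (IsState.map hΦ (hρ x)).1.1
  have hent : ∀ {Φ : SuperOp n}, IsChannel Φ → entropy (idTensor (Fin k) Φ (cqState p ρ)) =
      ∑ x, (p x * entropy (Φ (ρ x)) + Real.negMulLog (p x)) := fun {Φ} hΦ => by
    have h : ∀ x, ((p x : ℂ) • Φ (ρ x)).IsHermitian := fun x =>
      (posSemidef_ofReal_smul (IsState.map hΦ (hρ x)).1 (hp x)).1
    rw [cqState_eq_blockSum, idTensor_blockSum]
    simp only [map_smul]
    rw [entropy_blockSum h]
    refine Finset.sum_congr rfl fun x _ => ?_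
    rw [entropy_real_smul (hherm hΦ x), (IsState.map hΦ (hρ x)).2, Complex.one_re, mul_one]
  rw [realRelEntropy_idTensor hP hΨ hPΨ hω, hent hΨ, hent hP.channel, cqState_eq_blockSum,
    marginalSnd_blockSum, map_sum, map_sum, ← Finset.sum_sub_distrib, ← Finset.sum_sub_distrib,
    Finset.sum_mul, Matrix.trace_sum, Complex.re_sum, ← Finset.sum_sub_distrib]
  refine Finset.sum_congr rfl fun x _ => ?_
  rw [realRelEntropy_comp hP hΨ hPΨ (hρ x).1, map_smul, map_smul, ← smul_sub, Matrix.smul_mul,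
    Matrix.trace_smul, smul_eq_mul, Complex.re_ofReal_mul]
  ring

/-- A channel on `B` does not change the marginal on `X`, so differences of mutual information are
differences of coherent information. -/
theorem holevo_sub_le {R : EReal}
    (hR : ∀ ρ : Matrix n n ℂ, IsState ρ → (realRelEntropy (Ψ ρ) (P ρ) : EReal) ≤ R) :
    holevo Ψ - holevo P ≤ R := by
  refine EReal.sub_le_of_le_add (sSup_le ?_)
  rintro r ⟨k, p, ρ, hp, hp1, hρ, rfl⟩
  have hω : (cqState p ρ).PosSemidef := cqState_posSemidef hp fun x => (hρ x).1
  have h := coherentInfo_sub_le hP hΨ hPΨ hω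
  rw [realRelEntropy_idTensor_cqState hP hΨ hPΨ hp hρ] at h
  have hsum : ((∑ x, p x * realRelEntropy (Ψ (ρ x)) (P (ρ x)) : ℝ) : EReal) ≤ R := by
    -- `R = ⊥` is impossible: the weights sum to `1`, so there is at least one state, and its real
    -- relative entropy would be at most `⊥`.
    induction R with
    | bot =>
      obtain ⟨x, -⟩ := Finset.exists_ne_zero_of_sum_ne_zero (hp1 ▸ one_ne_zero)
      exact absurd (hR _ (hρ x)) (by simp)
    | top => exact le_top
    | coe R =>
      rw [EReal.coe_le_coe_iff]
      calc _ ≤ ∑ x, p x * R := Finset.sum_le_sum fun x _ =>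
            mul_le_mul_of_nonneg_left (by exact_mod_cast hR _ (hρ x)) (hp x)
        _ = R := by rw [← Finset.sum_mul, hp1, one_mul]
  calc (mutualInfo (idTensor (Fin k) Ψ (cqState p ρ)) : EReal) ≤
      ((∑ x, p x * realRelEntropy (Ψ (ρ x)) (P (ρ x)) +
        mutualInfo (idTensor (Fin k) P (cqState p ρ)) : ℝ) : EReal) := by
        rw [EReal.coe_le_coe_iff, mutualInfo, mutualInfo, marginalFst_idTensor hΨ,
          marginalFst_idTensor hP.channel]
        simp only [coherentInfo] at h
        linarith
    _ ≤ _ := by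
      rw [EReal.coe_add]
      exact add_le_add hsum (le_sSup ⟨k, p, ρ, hp, hp1, hρ, rfl⟩)

end Comparison

/-! ### Symmetric contractions on an inner product space -/

section SymmetricContraction

variable {V : Type*} [NormedAddCommGroup V] [InnerProductSpace ℂ V]

theorem mem_span_real_eigenvectors [FiniteDimensional ℂ V] {S : V →ₗ[ℂ] V} (hS : S.IsSymmetric)
    (hc : ∀ x, ‖S x‖ ≤ ‖x‖) (x : V) :
    x ∈ Submodule.span ℂ {x | ∃ r : ℝ, |r| ≤ 1 ∧ S x = (r : ℂ) • x} := by
  have htop : (⨆ μ, Module.End.eigenspace S μ) = ⊤ :=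
    Submodule.orthogonal_eq_bot_iff.1 hS.orthogonalComplement_iSup_eigenspaces_eq_bot
  have hle : (⨆ μ, Module.End.eigenspace S μ) ≤
      Submodule.span ℂ {x | ∃ r : ℝ, |r| ≤ 1 ∧ S x = (r : ℂ) • x} := by
    refine iSup_le fun μ y hy => ?_
    by_cases hy0 : y = 0
    · rw [hy0]; exact zero_mem _
    have hμ := hS.conj_eigenvalue_eq_self (Module.End.hasEigenvalue_of_hasEigenvector ⟨hy, hy0⟩)
    obtain ⟨r, rfl⟩ : ∃ a : ℝ, (a : ℂ) = μ := ⟨μ.re, Complex.conj_eq_iff_re.1 hμ⟩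
    rw [Module.End.mem_eigenspace_iff] at hy
    refine Submodule.subset_span ⟨r, ?_, hy⟩
    have h := hc y
    rw [hy, norm_smul, Complex.norm_real, Real.norm_eq_abs] at h
    exact le_of_mul_le_mul_right (by simpa using h) (norm_pos_iff.2 hy0)
  exact hle (htop ▸ Submodule.mem_top)

theorem apply_apply_of_unit_eigenvector {S : V →ₗ[ℂ] V} (hS : S.IsSymmetric) {z : ℂ}
    (hz : ‖z‖ = 1) {x : V} (hx : S x = z • x) : S (S x) = x := by
  by_cases hx0 : x = 0
  · rw [hx0, map_zero, map_zero]
  have hμ := hS.conj_eigenvalue_eq_self (Module.End.hasEigenvalue_of_hasEigenvector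
    ⟨Module.End.mem_eigenspace_iff.2 hx, hx0⟩)
  have h1 : z * z = 1 := by
    have h := Complex.mul_conj' z
    rw [hμ, hz] at h
    simpa using h
  rw [hx, map_smul, hx, smul_smul, h1, one_smul]

/-- Since `T 1 = (T (1/2))²` is a positive operator, the eigenvalue `-1` is excluded. The argument
uses only norms and the semigroup law, not continuity in `t`. -/
theorem semigroup_apply_of_unit_eigenvector {T : ℝ → V →ₗ[ℂ] V}
    (hT : ∀ t, 0 ≤ t → (T t).IsSymmetric) (hc : ∀ t, 0 ≤ t → ∀ x, ‖T t x‖ ≤ ‖x‖)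
    (hadd : ∀ s t, T (s + t) = T s * T t) {z : ℂ} (hz : ‖z‖ = 1) {x : V} (hx : T 1 x = z • x)
    {t : ℝ} (ht : 0 ≤ t) : T t x = x := by
  have h2 : T (1 + 1) x = x := by
    rw [hadd]
    exact apply_apply_of_unit_eigenvector (hT 1 zero_le_one) hz hx
  -- `T 2` fixes `x` and factors as `T (2 - s) * T s` into contractions, so no norm is lost on the
  -- way.
  have hnorm : ∀ s, 0 ≤ s → s ≤ 1 → ‖T s x‖ = ‖x‖ := fun s hs hs1 => by
    refine le_antisymm (hc s hs x) ?_
    have h : T (1 + 1) x = T (1 + 1 - s) (T s x) := by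
      rw [← Module.End.mul_apply, ← hadd, sub_add_cancel]
    rw [h2] at h
    conv_lhs => rw [h]
    exact hc _ (by linarith) _
  have hunit : ∀ s, 0 ≤ s → s ≤ 1 → T s x = x := fun s hs hs1 => by
    -- `⟨T s x, x⟩ = ‖T (s/2) x‖² = ‖x‖²`: the equality case of Cauchy-Schwarz, whence `T s x = x`.
    have h3 : inner ℂ (T s x) x = ((‖x‖ ^ 2 : ℝ) : ℂ) := by
      have h4 : T s x = T (s / 2) (T (s / 2) x) := by
        rw [← Module.End.mul_apply, ← hadd, add_halves]
      rw [h4, hT _ (by positivity), inner_self_eq_norm_sq_to_K, hnorm _ (by positivity) (by linarith)]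
      simp
    have h5 : ‖T s x - x‖ ^ 2 ≤ 0 := by
      have h7 : RCLike.re ((‖x‖ ^ 2 : ℝ) : ℂ) = ‖x‖ ^ 2 := Complex.ofReal_re _
      rw [@norm_sub_sq ℂ, h3, hnorm s hs hs1, h7]
      linarith
    have h6 : ‖T s x - x‖ = 0 := by nlinarith [norm_nonneg (T s x - x)]
    exact sub_eq_zero.1 (norm_eq_zero.1 h6)
  have hnat : ∀ k : ℕ, T (k : ℝ) x = x := fun k => by
    induction k with
    | zero => simpa using hunit 0 le_rfl zero_le_one
    | succ k ih => rw [Nat.cast_succ, hadd, Module.End.mul_apply, hunit 1 zero_le_one le_rfl, ih]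
  have h := Nat.floor_le ht
  have h' := Nat.lt_floor_add_one t
  rw [← sub_add_cancel t (⌊t⌋₊ : ℝ), hadd, Module.End.mul_apply, hnat]
  exact hunit _ (by linarith) (by linarith)

end SymmetricContraction

/-! ### GNS-symmetric channels as symmetric contractions -/

section GNS

variable {n : Type*} [Fintype n] [DecidableEq n]

namespace IsGNSSymmetric

variable {Φ : SuperOp n} {σ : Matrix n n ℂ} (h : IsGNSSymmetric Φ σ) (hΦ : IsChannel Φ)
  (hσ : σ.PosDef)
include h hΦ

/-- Nondegeneracy of the trace pairing turns the symmetry condition into an intertwining of `Φ` with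
its adjoint by right multiplication with `σ`. -/
theorem map_mul (Y : Matrix n n ℂ) : Φ (Y * σ) = hsAdjoint Φ Y * σ :=
  Matrix.ext_iff_trace_mul_left.2 fun X => by
    rw [← trace_hsAdjoint_mul hΦ.completelyPositive, ← Matrix.mul_assoc, ← Matrix.mul_assoc, h]

theorem map_self : Φ σ = σ := by
  have h1 := h.map_mul hΦ 1
  rwa [hsAdjoint_one hΦ, Matrix.one_mul] at h1

include hσ

theorem map_eq (X : Matrix n n ℂ) : Φ X = hsAdjoint Φ (X * σ⁻¹) * σ := by
  rw [← h.map_mul hΦ, Matrix.nonsing_inv_mul_cancel_right _ _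
    ((Matrix.isUnit_iff_isUnit_det _).1 hσ.isUnit)]

theorem trace_symm (X Y : Matrix n n ℂ) :
    (Y * σ⁻¹ * (Φ X)ᴴ).trace = (Φ Y * σ⁻¹ * Xᴴ).trace := by
  rw [h.map_eq hΦ hσ Y, Matrix.mul_nonsing_inv_cancel_right _ _
    ((Matrix.isUnit_iff_isUnit_det _).1 hσ.isUnit), trace_hsAdjoint_mul hΦ.completelyPositive,
    hΦ.completelyPositive.map_conjTranspose]

/-- For `X = Y σ` this is the Kadison-Schwarz inequality for `Y` evaluated in the invariant state
`σ`. -/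
theorem trace_contraction (X : Matrix n n ℂ) :
    (Φ X * σ⁻¹ * (Φ X)ᴴ).trace.re ≤ (X * σ⁻¹ * Xᴴ).trace.re := by
  have hu := (Matrix.isUnit_iff_isUnit_det _).1 hσ.isUnit
  obtain ⟨Y, rfl⟩ : ∃ Y, X = Y * σ := ⟨X * σ⁻¹, (Matrix.nonsing_inv_mul_cancel_right _ _ hu).symm⟩
  have h1 := trace_mul_nonneg (hsAdjoint_schwarz hΦ Y) hσ.posSemidef
  rw [Matrix.sub_mul, Matrix.trace_sub, trace_hsAdjoint_mul hΦ.completelyPositive,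
    h.map_self hΦ] at h1
  have h2 := (Complex.le_def.1 h1).1
  rw [Complex.zero_re, Complex.sub_re] at h2
  rw [h.map_mul hΦ, Matrix.mul_nonsing_inv_cancel_right _ _ hu,
    Matrix.mul_nonsing_inv_cancel_right _ _ hu, conjTranspose_mul, conjTranspose_mul, hσ.1.eq,
    Matrix.trace_mul_comm Y, Matrix.trace_mul_comm (hsAdjoint Φ Y), Matrix.mul_assoc,
    Matrix.mul_assoc, Matrix.trace_mul_comm σ, Matrix.trace_mul_comm σ]
  linarith

/-- A GNS-symmetric channel is a symmetric contraction for `⟨X, Y⟩ = tr(Y σ⁻¹ X†)`. -/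
theorem isSymmetric_and_contraction :
    letI := Matrix.toMatrixNormedAddCommGroup σ⁻¹ hσ.inv
    letI := Matrix.toMatrixInnerProductSpace σ⁻¹ hσ.inv.posSemidef
    LinearMap.IsSymmetric (𝕜 := ℂ) (E := Matrix n n ℂ) Φ ∧ ∀ X : Matrix n n ℂ, ‖Φ X‖ ≤ ‖X‖ := by
  let := Matrix.toMatrixNormedAddCommGroup σ⁻¹ hσ.inv
  let := Matrix.toMatrixInnerProductSpace σ⁻¹ hσ.inv.posSemidef
  refine ⟨fun X Y => h.trace_symm hΦ hσ X Y, fun X => ?_⟩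
  refine le_of_sq_le_sq ?_ (norm_nonneg _)
  rw [@norm_sq_eq_re_inner ℂ, @norm_sq_eq_re_inner ℂ]
  exact h.trace_contraction hΦ hσ X

theorem mem_span_real_eigenvectors (X : Matrix n n ℂ) :
    X ∈ Submodule.span ℂ {X | ∃ r : ℝ, |r| ≤ 1 ∧ Φ X = (r : ℂ) • X} := by
  let := Matrix.toMatrixNormedAddCommGroup σ⁻¹ hσ.inv
  let := Matrix.toMatrixInnerProductSpace σ⁻¹ hσ.inv.posSemidef
  have h1 := h.isSymmetric_and_contraction hΦ hσ
  exact QDyn.mem_span_real_eigenvectors h1.1 h1.2 X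

theorem apply_apply_of_unit_eigenvector {z : ℂ} (hz : ‖z‖ = 1) {X : Matrix n n ℂ}
    (hX : Φ X = z • X) : Φ (Φ X) = X := by
  let := Matrix.toMatrixNormedAddCommGroup σ⁻¹ hσ.inv
  let := Matrix.toMatrixInnerProductSpace σ⁻¹ hσ.inv.posSemidef
  exact QDyn.apply_apply_of_unit_eigenvector (h.isSymmetric_and_contraction hΦ hσ).1 hz hX

end IsGNSSymmetric

theorem expSemigroup_add (L : SuperOp n) (s t : ℝ) :
    expSemigroup L (s + t) = expSemigroup L s * expSemigroup L t := by
  rw [expSemigroup, expSemigroup, expSemigroup, ← map_mul, ← Matrix.exp_add_of_commute, ← add_smul,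
    Complex.ofReal_add]
  exact ((Commute.refl _).smul_left _).smul_right _

theorem expSemigroup_zero (L : SuperOp n) : expSemigroup L 0 = 1 := by
  simp [expSemigroup]

theorem expSemigroup_natCast (L : SuperOp n) (k : ℕ) :
    expSemigroup L k = expSemigroup L 1 ^ k := by
  induction k with
  | zero => rw [Nat.cast_zero, pow_zero, expSemigroup_zero]
  | succ k ih => rw [Nat.cast_succ, expSemigroup_add, ih, pow_succ]

theorem expSemigroup_apply_of_unit_eigenvector {L : SuperOp n} {σ : Matrix n n ℂ}
    (hL : IsLindbladian L) (hσ : σ.PosDef)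
    (h : ∀ t : ℝ, 0 ≤ t → IsGNSSymmetric (expSemigroup L t) σ) {z : ℂ} (hz : ‖z‖ = 1)
    {X : Matrix n n ℂ} (hX : expSemigroup L 1 X = z • X) {t : ℝ} (ht : 0 ≤ t) :
    expSemigroup L t X = X := by
  let := Matrix.toMatrixNormedAddCommGroup σ⁻¹ hσ.inv
  let := Matrix.toMatrixInnerProductSpace σ⁻¹ hσ.inv.posSemidef
  have h1 := fun t ht => (h t ht).isSymmetric_and_contraction (hL t ht) hσ
  exact semigroup_apply_of_unit_eigenvector (fun t ht => (h1 t ht).1) (fun t ht => (h1 t ht).2)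
    (expSemigroup_add L) hz hX ht

end GNS

/-! ### Peripheral projections: tensoring, existence, invariance -/

section Peripheral

variable {n : Type*}

/-- The common peripheral subspace of a family of maps. -/
def commonPeripheral {ι : Type*} (Ψ : ι → SuperOp n) : Submodule ℂ (Matrix n n ℂ) :=
  Submodule.span ℂ {X | ∀ i, ∃ z : ℂ, ‖z‖ = 1 ∧ Ψ i X = z • X}

theorem peripheralSubspace_eq (Φ : SuperOp n) :
    peripheralSubspace Φ = commonPeripheral fun _ : Unit => Φ := by
  simp [peripheralSubspace, commonPeripheral]

theorem semigroupPeripheralSubspace_eq (T : ℝ → SuperOp n) :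
    semigroupPeripheralSubspace T = commonPeripheral fun t : {t : ℝ // 0 ≤ t} => T t := by
  simp [semigroupPeripheralSubspace, commonPeripheral]

theorem peripheralProjection_eq [Finite n] {Φ P : SuperOp n} (h : IsPeripheralProjection Φ P) :
    peripheralProjection Φ = P :=
  (Classical.epsilon_spec (p := IsPeripheralProjection Φ) ⟨P, h⟩).unique h

theorem semigroupPeripheralProjection_eq [Finite n] {T : ℝ → SuperOp n} {P : SuperOp n}
    (hT : ∀ s t : ℝ, 0 ≤ s → 0 ≤ t → ∀ X, T s (T t X) = T t (T s X))
    (h : IsSemigroupPeripheralProjection T P) : semigroupPeripheralProjection T = P :=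
  (Classical.epsilon_spec (p := IsSemigroupPeripheralProjection T) ⟨P, h⟩).unique hT h

section Tensor

variable {m : Type*}

/-- Each block of an eigenvector of `id ⊗ Ψ i` satisfies the eigenvector equation of `Ψ i` with the
same eigenvalue. -/
theorem block_mem_commonPeripheral {ι : Type*} {Ψ : ι → SuperOp n} {X : Matrix (m × n) (m × n) ℂ}
    (hX : X ∈ commonPeripheral fun i => idTensor m (Ψ i)) (x y : m) :
    (Matrix.of fun a b => X (x, a) (y, b)) ∈ commonPeripheral Ψ := by
  refine Submodule.span_induction (p := fun X _ =>
    (Matrix.of fun a b => X (x, a) (y, b)) ∈ commonPeripheral Ψ) ?_ ?_ ?_ ?_ hX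
  · intro X hX
    refine Submodule.subset_span fun i => ?_
    obtain ⟨z, hz, h⟩ := hX i
    exact ⟨z, hz, (idTensor_block (Ψ i) X x y).symm.trans (by rw [h]; rfl)⟩
  · exact zero_mem _
  · exact fun X Y _ _ h1 h2 => add_mem h1 h2
  · exact fun c X _ h => Submodule.smul_mem _ c h

open scoped Kronecker in
theorem mem_commonPeripheral_of_blocks [Fintype m] [DecidableEq m] {ι : Type*}
    {Ψ : ι → SuperOp n} {X : Matrix (m × n) (m × n) ℂ}
    (hX : ∀ x y, (Matrix.of fun a b => X (x, a) (y, b)) ∈ commonPeripheral Ψ) :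
    X ∈ commonPeripheral fun i => idTensor m (Ψ i) := by
  have h1 : X = ∑ x, ∑ y, Matrix.single x y (1 : ℂ) ⊗ₖ (Matrix.of fun a b => X (x, a) (y, b)) := by
    ext ⟨x, a⟩ ⟨y, b⟩
    simp only [Matrix.sum_apply, Matrix.kroneckerMap_apply, Matrix.single_apply, of_apply]
    rw [Finset.sum_eq_single x (fun z _ hz => by simp [hz]) (by simp),
      Finset.sum_eq_single y (fun z _ hz => by simp [hz]) (by simp)]
    simp
  rw [h1]
  refine sum_mem fun x _ => sum_mem fun y _ => ?_
  refine Submodule.span_induction (p := fun B _ => Matrix.single x y (1 : ℂ) ⊗ₖ B ∈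
    commonPeripheral fun i => idTensor m (Ψ i)) ?_ ?_ ?_ ?_ (hX x y)
  · intro B hB
    refine Submodule.subset_span fun i => ?_
    obtain ⟨z, hz, h⟩ := hB i
    exact ⟨z, hz, by rw [idTensor_kronecker, h, kronecker_smul]⟩
  · rw [kronecker_zero]
    exact zero_mem _
  · intro A B _ _ h2 h3
    rw [kronecker_add]
    exact add_mem h2 h3
  · intro c A _ h2
    rw [kronecker_smul]
    exact Submodule.smul_mem _ c h2

theorem idTensor_fixed {ι : Type*} {Ψ : ι → SuperOp n} {P : SuperOp n}
    (hP : ∀ X ∈ commonPeripheral Ψ, P X = X) {X : Matrix (m × n) (m × n) ℂ}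
    (hX : X ∈ commonPeripheral fun i => idTensor m (Ψ i)) : idTensor m P X = X := by
  ext ⟨x, a⟩ ⟨y, b⟩
  exact congrFun (congrFun (hP _ (block_mem_commonPeripheral hX x y)) a) b

theorem range_idTensor [Fintype m] [DecidableEq m] {ι : Type*} {Ψ : ι → SuperOp n}
    {P : SuperOp n} (hr : LinearMap.range P = commonPeripheral Ψ)
    (hP : ∀ X ∈ commonPeripheral Ψ, P X = X) :
    LinearMap.range (idTensor m P) = commonPeripheral fun i => idTensor m (Ψ i) := by
  refine le_antisymm ?_ fun X hX => ⟨X, idTensor_fixed hP hX⟩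
  rintro _ ⟨X, rfl⟩
  refine mem_commonPeripheral_of_blocks fun x y => ?_
  rw [idTensor_block, ← hr]
  exact LinearMap.mem_range_self _ _

theorem tendsto_idTensor {S : ℕ → SuperOp n} {P : SuperOp n}
    (h : ∀ X, Tendsto (fun i => S i X) atTop (𝓝 (P X))) (X : Matrix (m × n) (m × n) ℂ) :
    Tendsto (fun i => idTensor m (S i) X) atTop (𝓝 (idTensor m P X)) :=
  tendsto_pi_nhds.2 fun p => tendsto_pi_nhds.2 fun q =>
    tendsto_pi_nhds.1 (tendsto_pi_nhds.1 (h (Matrix.of fun a b => X (p.1, a) (q.1, b))) p.2) q.2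

theorem idTensor_pow (Φ : SuperOp n) (k : ℕ) : idTensor m Φ ^ k = idTensor m (Φ ^ k) := by
  induction k with
  | zero => rfl
  | succ k ih => rw [pow_succ, pow_succ, ih]; rfl

theorem IsPeripheralProjection.idTensor [Fintype m] [DecidableEq m] {Φ P : SuperOp n}
    (h : IsPeripheralProjection Φ P) :
    IsPeripheralProjection (idTensor m Φ) (idTensor m P) := by
  obtain ⟨hr, ⟨k, hk, hlim⟩, hfix⟩ := h
  rw [peripheralSubspace_eq] at hr hfix
  refine ⟨?_, ⟨k, hk, fun X => ?_⟩, fun X hX => ?_⟩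
  · rw [peripheralSubspace_eq, range_idTensor hr hfix]
  · simp only [idTensor_pow]
    exact tendsto_idTensor hlim X
  · rw [peripheralSubspace_eq] at hX
    exact idTensor_fixed hfix hX

theorem IsSemigroupPeripheralProjection.idTensor [Fintype m] [DecidableEq m] {T : ℝ → SuperOp n}
    {P : SuperOp n} (h : IsSemigroupPeripheralProjection T P) :
    IsSemigroupPeripheralProjection (fun t => idTensor m (T t)) (idTensor m P) := by
  obtain ⟨hr, ⟨k, hk, hk0, hlim⟩, hfix⟩ := h
  rw [semigroupPeripheralSubspace_eq] at hr hfix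
  refine ⟨?_, ⟨k, hk, hk0, tendsto_idTensor hlim⟩, fun X hX => ?_⟩
  · rw [semigroupPeripheralSubspace_eq, range_idTensor hr hfix]
  · rw [semigroupPeripheralSubspace_eq] at hX
    exact idTensor_fixed hfix hX

end Tensor

section Limits

variable [Fintype n]

theorem posSemidef_of_tendsto {S : ℕ → Matrix n n ℂ} {A : Matrix n n ℂ}
    (hS : ∀ i, (S i).PosSemidef) (h : Tendsto S atTop (𝓝 A)) : A.PosSemidef := by
  refine PosSemidef.of_dotProduct_mulVec_nonneg ?_ fun v => ?_
  · have h1 : Tendsto (fun i => (S i)ᴴ) atTop (𝓝 Aᴴ) :=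
      ((continuous_id.matrix_conjTranspose).tendsto A).comp h
    simp only [(hS _).1.eq] at h1
    exact tendsto_nhds_unique h1 h
  · have hc : Continuous fun B : Matrix n n ℂ => star v ⬝ᵥ (B *ᵥ v) :=
      Continuous.dotProduct continuous_const (continuous_id.matrix_mulVec continuous_const)
    exact ge_of_tendsto ((hc.tendsto A).comp h)
      (Eventually.of_forall fun i => (hS i).dotProduct_mulVec_nonneg v)

theorem IsChannel.of_tendsto {S : ℕ → SuperOp n} {P : SuperOp n} (hS : ∀ i, IsChannel (S i))
    (h : ∀ X, Tendsto (fun i => S i X) atTop (𝓝 (P X))) : IsChannel P where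
  completelyPositive k X hX := posSemidef_of_tendsto
    (fun i => (hS i).completelyPositive k X hX) (tendsto_idTensor h X)
  trace_map X := by
    have hc : Continuous fun B : Matrix n n ℂ => B.trace := continuous_id.matrix_trace
    have h1 := (hc.tendsto _).comp (h X)
    simp only [Function.comp_def, (hS _).trace_map] at h1
    exact tendsto_nhds_unique h1 tendsto_const_nhds

theorem IsChannel.one : IsChannel (1 : SuperOp n) :=
  ⟨fun _ _ hX => hX, fun _ => rfl⟩

theorem IsChannel.mul {Φ Ψ : SuperOp n} (hΦ : IsChannel Φ) (hΨ : IsChannel Ψ) :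
    IsChannel (Φ * Ψ) :=
  ⟨fun k X hX => hΦ.completelyPositive k _ (hΨ.completelyPositive k X hX),
    fun X => (hΦ.trace_map _).trans (hΨ.trace_map X)⟩

theorem IsChannel.pow {Φ : SuperOp n} (hΦ : IsChannel Φ) (k : ℕ) : IsChannel (Φ ^ k) := by
  induction k with
  | zero => exact IsChannel.one
  | succ k ih => rw [pow_succ]; exact ih.mul hΦ

end Limits

section Existence

variable [Fintype n]

-- Even powers converge: real eigenvalues of modulus below `1` die out, and `±1` square to `1`.
-- Convergence on eigenvectors extends to their span, and uniqueness of limits makes the limit map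
-- linear.
omit [Fintype n] in
theorem exists_isPeripheralProjection {Φ : SuperOp n}
    (h1 : ∀ X, X ∈ Submodule.span ℂ {X | ∃ r : ℝ, |r| ≤ 1 ∧ Φ X = (r : ℂ) • X})
    (h2 : ∀ X, ∀ z : ℂ, ‖z‖ = 1 → Φ X = z • X → Φ (Φ X) = X) :
    ∃ P, IsPeripheralProjection Φ P := by
  have heig : ∀ (X : Matrix n n ℂ) (r : ℂ), Φ X = r • X → ∀ k, (Φ ^ k) X = r ^ k • X := by
    intro X r hr k
    induction k with
    | zero => simp
    | succ k ih => rw [pow_succ, Module.End.mul_apply, hr, map_smul, ih, smul_smul, pow_succ']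
  have hconv : ∀ X, ∃ Y ∈ peripheralSubspace Φ,
      Tendsto (fun i => (Φ ^ (2 * i)) X) atTop (𝓝 Y) := fun X => by
    refine Submodule.span_induction (p := fun X _ => ∃ Y ∈ peripheralSubspace Φ,
      Tendsto (fun i => (Φ ^ (2 * i)) X) atTop (𝓝 Y)) ?_ ?_ ?_ ?_ (h1 X)
    · rintro X ⟨r, hr, hX⟩
      rcases hr.lt_or_eq with hr | hr
      · refine ⟨0, zero_mem _, ?_⟩
        simp only [heig X r hX]
        simp only [pow_mul]
        have h3 : ‖(r : ℂ) ^ 2‖ < 1 := by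
          rw [norm_pow, Complex.norm_real, Real.norm_eq_abs]
          exact pow_lt_one₀ (abs_nonneg r) hr two_ne_zero
        simpa using (tendsto_pow_atTop_nhds_zero_of_norm_lt_one h3).smul_const X
      · refine ⟨X, Submodule.subset_span ⟨r, by simpa using hr, hX⟩, ?_⟩
        simp only [heig X r hX]
        have h3 : (r : ℂ) ^ 2 = 1 := by
          rw [← Complex.ofReal_pow, ← sq_abs, hr]
          simp
        simp only [pow_mul, h3, one_pow, one_smul]
        exact tendsto_const_nhds
    · exact ⟨0, zero_mem _, by simp⟩
    · rintro X Y - - ⟨A, hA, hA'⟩ ⟨B, hB, hB'⟩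
      exact ⟨A + B, add_mem hA hB, by simpa using hA'.add hB'⟩
    · rintro c X - ⟨A, hA, hA'⟩
      exact ⟨c • A, Submodule.smul_mem _ c hA, by simpa using hA'.const_smul c⟩
  choose f hf hlim using hconv
  let P : SuperOp n :=
    { toFun := f
      map_add' := fun X Y => tendsto_nhds_unique (hlim _) (by simpa using (hlim X).add (hlim Y))
      map_smul' := fun c X => tendsto_nhds_unique (hlim _) (by simpa using (hlim X).const_smul c) }
  have hfix : ∀ X ∈ peripheralSubspace Φ, P X = X := fun X hX => by
    refine Submodule.span_induction (p := fun X _ => P X = X) ?_ ?_ ?_ ?_ hX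
    · rintro X ⟨z, hz, hX⟩
      refine tendsto_nhds_unique (hlim X) ?_
      have h3 : ∀ i, (Φ ^ (2 * i)) X = X := fun i => by
        induction i with
        | zero => simp
        | succ i ih =>
          rw [Nat.mul_succ, pow_add, Module.End.mul_apply, pow_two, Module.End.mul_apply,
            h2 X z hz hX, ih]
      simp only [h3]
      exact tendsto_const_nhds
    · exact map_zero P
    · intro X Y _ _ hX hY
      rw [map_add, hX, hY]
    · intro c X _ hX
      rw [map_smul, hX]
  refine ⟨P, ?_, ⟨fun i => 2 * i, fun i j h => Nat.mul_le_mul_left 2 h, hlim⟩, hfix⟩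
  refine le_antisymm ?_ fun X hX => ⟨X, hfix X hX⟩
  rintro _ ⟨X, rfl⟩
  exact hf X

namespace IsPeripheralProjection

variable {Φ P : SuperOp n} (h : IsPeripheralProjection Φ P)
include h

omit [Fintype n] in
theorem apply_mem (X : Matrix n n ℂ) : P X ∈ peripheralSubspace Φ :=
  h.range_eq ▸ LinearMap.mem_range_self P X

omit [Fintype n] in
theorem idem (X : Matrix n n ℂ) : P (P X) = P X := h.fixed _ (h.apply_mem X)

theorem comm (X : Matrix n n ℂ) : P (Φ X) = Φ (P X) := by
  obtain ⟨k, -, hk⟩ := h.exists_tendsto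
  refine (comm_of_tendsto (R := fun _ => Φ) (Q := Φ) (fun i j X => ?_) hk
    (fun X => tendsto_const_nhds) X)
  rw [← Module.End.mul_apply, ← Module.End.mul_apply, ← pow_succ, ← pow_succ']

theorem comm_pow (k : ℕ) (X : Matrix n n ℂ) : P ((Φ ^ k) X) = (Φ ^ k) (P X) := by
  induction k generalizing X with
  | zero => rfl
  | succ k ih => rw [pow_succ, Module.End.mul_apply, Module.End.mul_apply, ih, h.comm]

theorem isFaithfulIdempotent (hΦ : IsChannel Φ) {σ : Matrix n n ℂ} (hσ : σ.PosDef)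
    (hfix : Φ σ = σ) : IsFaithfulIdempotent P where
  channel := by
    obtain ⟨k, -, hk⟩ := h.exists_tendsto
    exact IsChannel.of_tendsto (fun i => hΦ.pow (k i)) hk
  idem := h.idem
  exists_posDef := ⟨σ, hσ, h.fixed σ (Submodule.subset_span ⟨1, by simp, by simpa using hfix⟩)⟩

/-- `Φ²` is the identity on the range of `P`, and `P` commutes with `Φ`. An odd power could still
act on this range with eigenvalue `-1`. -/
theorem apply_pow_two_mul
    (h2 : ∀ X, ∀ z : ℂ, ‖z‖ = 1 → Φ X = z • X → Φ (Φ X) = X) (k : ℕ) (X : Matrix n n ℂ) :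
    P ((Φ ^ (2 * k)) X) = P X := by
  have h3 : Φ (Φ (P X)) = P X := by
    refine Submodule.span_induction (p := fun X _ => Φ (Φ X) = X) ?_ ?_ ?_ ?_ (h.apply_mem X)
    · rintro X ⟨z, hz, hX⟩
      exact h2 X z hz hX
    · simp
    · intro X Y _ _ hX hY
      rw [map_add, map_add, hX, hY]
    · intro c X _ hX
      rw [map_smul, map_smul, hX]
  rw [h.comm_pow]
  induction k with
  | zero => rfl
  | succ k ih =>
    rw [Nat.mul_succ, pow_add, Module.End.mul_apply, pow_two, Module.End.mul_apply, h3, ih]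

end IsPeripheralProjection

end Existence

end Peripheral

/-! ### From contraction coefficients and Pimsner-Popa constants to entropy bounds -/

section Bounds

theorem expNeg_antitone : Antitone expNeg := fun _ _ h =>
  EReal.coe_ennreal_le_coe_ennreal_iff.2 (EReal.exp_monotone
    (EReal.neg_le_neg_iff.2 (EReal.coe_ennreal_le_coe_ennreal_iff.2 h)))

theorem expNeg_nonneg (x : ℝ≥0∞) : 0 ≤ expNeg x := EReal.coe_ennreal_nonneg _

theorem expNeg_zero : expNeg 0 = 1 := by simp [expNeg]

theorem expNeg_ofReal {x : ℝ} (hx : 0 ≤ x) : expNeg (ENNReal.ofReal x) = (Real.exp (-x) : EReal) := by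
  rw [expNeg, EReal.coe_ennreal_ofReal, max_eq_left hx, ← EReal.coe_neg, EReal.exp_coe,
    EReal.coe_ennreal_ofReal, max_eq_left (Real.exp_pos _).le]

/-- Exponential contraction at all rates in `S` gives contraction at the supremum of `S`. -/
theorem le_expNeg_iSup_mul {S : ℝ≥0 → Prop} {D D₀ t : ℝ} {R : EReal} (hR : (D : EReal) ≤ R)
    (h₀ : 0 ≤ D₀) (h₀R : (D₀ : EReal) ≤ R) (ht : 0 ≤ t)
    (hS : ∀ a : ℝ≥0, S a → D ≤ Real.exp (-(2 * a * t)) * D₀) :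
    (D : EReal) ≤ expNeg (2 * (⨆ (a : ℝ≥0) (_ : S a), (a : ℝ≥0∞)) * ENNReal.ofReal t) * R := by
  have hR0 : 0 ≤ R := le_trans (by exact_mod_cast h₀) h₀R
  rcases le_or_gt D 0 with hD | hD
  · exact le_trans (by exact_mod_cast hD) (mul_nonneg (expNeg_nonneg _) hR0)
  by_cases hne : ∃ a, S a
  · have hpos : 0 < D₀ := by
      obtain ⟨a, ha⟩ := hne
      have := hS a ha
      by_contra hcon
      have h1 : D₀ = 0 := le_antisymm (not_lt.1 hcon) h₀
      rw [h1, mul_zero] at this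
      linarith
    -- Each admissible rate satisfies `2 a t ≤ log (D₀ / D)`, so the supremum does too, whether or
    -- not it is attained or `t = 0`.
    have hlog : ∀ a : ℝ≥0, S a → 2 * (a : ℝ) * t ≤ Real.log (D₀ / D) := fun a ha => by
      rw [Real.le_log_iff_exp_le (by positivity), le_div_iff₀ hD]
      have h1 := hS a ha
      rw [Real.exp_neg] at h1
      calc Real.exp (2 * a * t) * D ≤ Real.exp (2 * a * t) * ((Real.exp (2 * a * t))⁻¹ * D₀) :=
            mul_le_mul_of_nonneg_left h1 (Real.exp_pos _).le
        _ = D₀ := by rw [mul_inv_cancel_left₀ (Real.exp_pos _).ne']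
    have hL0 : 0 ≤ Real.log (D₀ / D) := by
      obtain ⟨a, ha⟩ := hne
      exact le_trans (by positivity) (hlog a ha)
    have hsup : 2 * (⨆ (a : ℝ≥0) (_ : S a), (a : ℝ≥0∞)) * ENNReal.ofReal t ≤
        ENNReal.ofReal (Real.log (D₀ / D)) := by
      rw [ENNReal.mul_iSup, ENNReal.iSup_mul]
      refine iSup_le fun a => ?_
      rw [ENNReal.mul_iSup, ENNReal.iSup_mul]
      refine iSup_le fun ha => ?_
      have h1 : (2 : ℝ≥0∞) * a * ENNReal.ofReal t = ENNReal.ofReal (2 * a * t) := by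
        rw [ENNReal.ofReal_mul (by positivity), ENNReal.ofReal_mul (by positivity)]
        simp
      rw [h1]
      exact ENNReal.ofReal_le_ofReal (hlog a ha)
    have h1 := expNeg_antitone hsup
    rw [expNeg_ofReal hL0, ← Real.log_inv, Real.exp_log (by positivity), inv_div] at h1
    calc (D : EReal) = ((D / D₀ : ℝ) : EReal) * (D₀ : EReal) := by
          rw [← EReal.coe_mul, div_mul_cancel₀ _ hpos.ne']
      _ ≤ _ := mul_le_mul_of_nonneg h1 h₀R (by exact_mod_cast (by positivity)) hR0
  -- With no admissible rate the factor is `1` and the direct bound `D ≤ R` suffices; monotonicity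
  -- of relative entropy under channels is thus never needed.
  · have h1 : (⨆ (a : ℝ≥0) (_ : S a), (a : ℝ≥0∞)) = 0 := by
      refine le_antisymm (iSup_le fun a => iSup_le fun ha => absurd ⟨a, ha⟩ hne) zero_le
    rw [h1, mul_zero, zero_mul, expNeg_zero, one_mul]
    exact hR

variable {n : Type*} [Fintype n] [DecidableEq n]

theorem IsFaithfulIdempotent.realRelEntropy_nonneg {P : SuperOp n} (hP : IsFaithfulIdempotent P)
    {ρ : Matrix n n ℂ} (hρ : ρ.PosSemidef) : 0 ≤ realRelEntropy ρ (P ρ) :=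
  realRelEntropy_map_nonneg hP IsChannel.one (fun _ => rfl) hρ

theorem IsFaithfulIdempotent.realRelEntropy_le_log_pimsnerPopa {P : SuperOp n}
    (hP : IsFaithfulIdempotent P) {ρ : Matrix n n ℂ} (hρ : IsState ρ) :
    (realRelEntropy ρ (P ρ) : EReal) ≤ ENNReal.log (pimsnerPopa P) := by
  -- In exponential form the claim becomes a lower bound on an infimum over admissible `C`, and `Λ =
  -- ∞` needs no separate case.
  rw [← EReal.log_exp (realRelEntropy ρ (P ρ) : EReal)]
  refine ENNReal.log_monotone (le_iInf fun C => le_iInf fun hC => ?_)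
  have hC0 : (0 : ℝ) < C := by exact_mod_cast hC.1
  have h1 := realRelEntropy_le_log hρ (hP.channel.completelyPositive.map_posSemidef hρ.1) hC0
    (hC.2 ρ hρ.1)
  rw [EReal.exp_coe, ENNReal.ofReal_le_iff_le_toReal ENNReal.coe_ne_top, ENNReal.coe_toReal]
  rwa [← Real.le_log_iff_exp_le hC0]

/-- The one-step contraction iterates because `Φ(P ρ) = P(Φ ρ)`: the reference state after each step
is again the projection of the current state. -/
theorem HasEntropyContraction.realRelEntropy_pow_le {Φ P : SuperOp n} {a : ℝ}
    (ha : HasEntropyContraction Φ a) (hΦ : IsChannel Φ) (h : IsPeripheralProjection Φ P)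
    (hP : IsFaithfulIdempotent P) (k : ℕ) {ρ : Matrix n n ℂ} (hρ : IsState ρ) :
    realRelEntropy ((Φ ^ k) ρ) (P ((Φ ^ k) ρ)) ≤ Real.exp (-(a * k)) * realRelEntropy ρ (P ρ) := by
  induction k with
  | zero => simp
  | succ k ih =>
    have hs := IsState.map (hΦ.pow k) hρ
    have h1 := ha _ hs
    rw [peripheralProjection_eq h, ← h.comm, relEntropy_of_ker_le (hP.ker_le hs.1),
      relEntropy_of_ker_le (hP.ker_le (IsState.map hΦ hs).1), ← EReal.coe_mul,
      EReal.coe_le_coe_iff] at h1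
    rw [pow_succ', Module.End.mul_apply]
    calc _ ≤ _ := h1
      _ ≤ Real.exp (-a) * (Real.exp (-(a * k)) * realRelEntropy ρ (P ρ)) :=
        mul_le_mul_of_nonneg_left ih (Real.exp_pos _).le
      _ = _ := by
        rw [← mul_assoc, ← Real.exp_add]
        congr 2
        push_cast
        ring

theorem realRelEntropy_pow_le_expNeg_alpha {Φ P : SuperOp n} (hΦ : IsChannel Φ)
    (h : IsPeripheralProjection Φ P) (hP : IsFaithfulIdempotent P)
    (hinv : ∀ k X, P ((Φ ^ (2 * k)) X) = P X) (t : ℕ) {ρ : Matrix n n ℂ} (hρ : IsState ρ) :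
    (realRelEntropy ((Φ ^ (2 * t)) ρ) (P ρ) : EReal) ≤
      expNeg (2 * alpha Φ * t) * ENNReal.log (pimsnerPopa P) := by
  have h1 := hP.realRelEntropy_le_log_pimsnerPopa (IsState.map (hΦ.pow (2 * t)) hρ)
  rw [hinv] at h1
  have ht : (t : ℝ≥0∞) = ENNReal.ofReal (t : ℝ) := by simp
  rw [ht]
  refine le_expNeg_iSup_mul h1 (hP.realRelEntropy_nonneg hρ.1)
    (hP.realRelEntropy_le_log_pimsnerPopa hρ) (Nat.cast_nonneg t) fun a ha => ?_
  have h2 := HasEntropyContraction.realRelEntropy_pow_le ha hΦ h hP (2 * t) hρ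
  rw [hinv] at h2
  convert h2 using 3
  push_cast
  ring

/-- No iteration is required: the contraction is used once, at time `2t`, and `T (2t)` fixes `P ρ`.
-/
theorem realRelEntropy_semigroup_le_expNeg_alpha {T : ℝ → SuperOp n} {P : SuperOp n}
    (hT : ∀ t, 0 ≤ t → IsChannel (T t)) (h : semigroupPeripheralProjection T = P)
    (hP : IsFaithfulIdempotent P) (hPT : ∀ t, 0 ≤ t → ∀ X, P (T t X) = P X)
    (hTP : ∀ t, 0 ≤ t → ∀ X, T t (P X) = P X) {t : ℝ} (ht : 0 ≤ t) {ρ : Matrix n n ℂ}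
    (hρ : IsState ρ) :
    (realRelEntropy (T (2 * t) ρ) (P ρ) : EReal) ≤
      expNeg (2 * semigroupAlpha T * ENNReal.ofReal t) * ENNReal.log (pimsnerPopa P) := by
  have ht2 : 0 ≤ 2 * t := by positivity
  have hs := IsState.map (hT _ ht2) hρ
  have h1 := hP.realRelEntropy_le_log_pimsnerPopa hs
  have hk := hP.ker_le hs.1
  rw [hPT _ ht2] at h1 hk
  refine le_expNeg_iSup_mul h1 (hP.realRelEntropy_nonneg hρ.1)
    (hP.realRelEntropy_le_log_pimsnerPopa hρ) ht fun a ha => ?_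
  have h2 := ha (2 * t) ht2 ρ hρ
  rw [h, hTP _ ht2, relEntropy_of_ker_le hk, relEntropy_of_ker_le (hP.ker_le hρ.1), ← EReal.coe_mul,
    EReal.coe_le_coe_iff] at h2
  convert h2 using 3
  ring

theorem expNeg_mul_log_mono {x y t : ℝ≥0∞} (hxy : x ≤ y) {Λ Λ' : ℝ≥0∞} (hΛ : Λ ≤ Λ')
    (h0 : 0 ≤ ENNReal.log Λ) :
    expNeg (2 * y * t) * ENNReal.log Λ ≤ expNeg (2 * x * t) * ENNReal.log Λ' := by
  have h1 : 2 * x * t ≤ 2 * y * t := mul_le_mul' (mul_le_mul' le_rfl hxy) le_rfl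
  have h2 := expNeg_antitone h1
  have h3 := ENNReal.log_monotone hΛ
  exact mul_le_mul_of_nonneg h2 h3 (expNeg_nonneg _) (h0.trans h3)

theorem alphaC_le (Φ : SuperOp n) {d : ℕ} (hd : 0 < d) : alphaC Φ ≤ alpha (idTensor (Fin d) Φ) :=
  iInf_le (fun k : ℕ+ => alpha (idTensor (Fin k) Φ)) ⟨d, hd⟩

theorem semigroupAlphaC_le (T : ℝ → SuperOp n) {d : ℕ} (hd : 0 < d) :
    semigroupAlphaC T ≤ semigroupAlpha fun t => idTensor (Fin d) (T t) :=
  iInf_le (fun k : ℕ+ => semigroupAlpha fun t => idTensor (Fin k) (T t)) ⟨d, hd⟩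

omit [DecidableEq n] in
theorem le_pimsnerPopaC (P : SuperOp n) {d : ℕ} (hd : 0 < d) :
    pimsnerPopa (idTensor (Fin d) P) ≤ pimsnerPopaC P :=
  le_iSup (fun k : ℕ+ => pimsnerPopa (idTensor (Fin k) P)) ⟨d, hd⟩

end Bounds

/-! ### The two bounds -/

section Main

variable {d : ℕ}

theorem discrete_bound {Φ : SuperOp (Fin d)} {σ : Matrix (Fin d) (Fin d) ℂ} (hΦ : IsChannel Φ)
    (hσ : IsFaithfulState σ) (hG : IsGNSSymmetric Φ σ) (t : ℕ) :
    holevo (Φ ^ (2 * t)) - holevo (peripheralProjection Φ) ≤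
        expNeg (2 * alpha Φ * t) * ENNReal.log (pimsnerPopa (peripheralProjection Φ)) ∧
      channelCoherentInfo (Φ ^ (2 * t)) - channelCoherentInfo (peripheralProjection Φ) ≤
        expNeg (2 * alphaC Φ * t) * ENNReal.log (pimsnerPopaC (peripheralProjection Φ)) := by
  have h2 := fun X z hz hX => hG.apply_apply_of_unit_eigenvector hΦ hσ.1 (z := z) hz (X := X) hX
  obtain ⟨P, h⟩ := exists_isPeripheralProjection (hG.mem_span_real_eigenvectors hΦ hσ.1) h2
  have hP := h.isFaithfulIdempotent hΦ hσ.1 (hG.map_self hΦ)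
  have hinv := h.apply_pow_two_mul h2
  rw [peripheralProjection_eq h]
  refine ⟨holevo_sub_le hP (hΦ.pow _) (hinv t) fun ρ hρ =>
    realRelEntropy_pow_le_expNeg_alpha hΦ h hP hinv t hρ,
    channelCoherentInfo_sub_le hP (hΦ.pow _) (hinv t) fun ω hω => ?_⟩
  -- A state has trace `1`, so the dimension is positive, as it must be for `d` to be among the
  -- ancilla sizes in `alphaC` and `pimsnerPopaC`.
  have hd : 0 < d := by
    rcases Nat.eq_zero_or_pos d with rfl | hd
    · exact absurd hσ.2 (by simp [Matrix.trace])
    · exact hd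
  have hinv' : ∀ k X, idTensor (Fin d) P ((idTensor (Fin d) Φ ^ (2 * k)) X) =
      idTensor (Fin d) P X := fun k X => by
    rw [idTensor_pow, ← idTensor_idTensor_apply]
    exact congrArg (fun A => idTensor (Fin d) A X) (LinearMap.ext (hinv k))
  have h3 := realRelEntropy_pow_le_expNeg_alpha hΦ.idTensor h.idTensor
    (hP.idTensor (m := Fin d)) hinv' t hω
  rw [idTensor_pow] at h3
  refine h3.trans (expNeg_mul_log_mono (alphaC_le Φ hd) (le_pimsnerPopaC P hd) ?_)
  refine le_trans ?_ (hP.idTensor.realRelEntropy_le_log_pimsnerPopa hω)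
  exact_mod_cast hP.idTensor.realRelEntropy_nonneg hω.1

/-- Peripheral eigenvectors of the time-one map are fixed at all times, so the two peripheral
subspaces agree, and a limit along integer powers is a limit along times. -/
theorem IsPeripheralProjection.semigroup {L P : SuperOp (Fin d)}
    (h : IsPeripheralProjection (expSemigroup L 1) P)
    (hfix : ∀ X, ∀ z : ℂ, ‖z‖ = 1 → expSemigroup L 1 X = z • X → ∀ t : ℝ, 0 ≤ t →
      expSemigroup L t X = X) :
    IsSemigroupPeripheralProjection (expSemigroup L) P := by
  have hsub : peripheralSubspace (expSemigroup L 1) =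
      semigroupPeripheralSubspace (expSemigroup L) := by
    refine le_antisymm (Submodule.span_mono ?_) (Submodule.span_mono ?_)
    · rintro X ⟨z, hz, hX⟩ t ht
      exact ⟨1, by simp, by rw [one_smul]; exact hfix X z hz hX t ht⟩
    · intro X hX
      exact hX 1 zero_le_one
  obtain ⟨hr, ⟨k, hk, hlim⟩, hf⟩ := h
  rw [hsub] at hr hf
  refine ⟨hr, ⟨fun i => k i, fun i j hij => Nat.cast_le.2 (hk hij), fun i => Nat.cast_nonneg _,
    fun X => ?_⟩, hf⟩
  simp only [expSemigroup_natCast]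
  exact hlim X

theorem expSemigroup_comm (L : SuperOp (Fin d)) (s t : ℝ) (X : Matrix (Fin d) (Fin d) ℂ) :
    expSemigroup L s (expSemigroup L t X) = expSemigroup L t (expSemigroup L s X) := by
  rw [← Module.End.mul_apply, ← Module.End.mul_apply, ← expSemigroup_add, ← expSemigroup_add,
    add_comm]

theorem semigroup_bound {L : SuperOp (Fin d)} {σ : Matrix (Fin d) (Fin d) ℂ}
    (hL : IsLindbladian L) (hσ : IsFaithfulState σ)
    (hG : ∀ t : ℝ, 0 ≤ t → IsGNSSymmetric (expSemigroup L t) σ) {t : ℝ} (ht : 0 ≤ t) :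
    holevo (expSemigroup L (2 * t)) - holevo (semigroupPeripheralProjection (expSemigroup L)) ≤
        expNeg (2 * semigroupAlpha (expSemigroup L) * ENNReal.ofReal t) *
          ENNReal.log (pimsnerPopa (semigroupPeripheralProjection (expSemigroup L))) ∧
      channelCoherentInfo (expSemigroup L (2 * t)) -
          channelCoherentInfo (semigroupPeripheralProjection (expSemigroup L)) ≤
        expNeg (2 * semigroupAlphaC (expSemigroup L) * ENNReal.ofReal t) *
          ENNReal.log (pimsnerPopaC (semigroupPeripheralProjection (expSemigroup L))) := by
  have hG1 := hG 1 zero_le_one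
  have hL1 := hL 1 zero_le_one
  have hfix : ∀ X, ∀ z : ℂ, ‖z‖ = 1 → expSemigroup L 1 X = z • X → ∀ t : ℝ, 0 ≤ t →
      expSemigroup L t X = X := fun X z hz hX t ht =>
    expSemigroup_apply_of_unit_eigenvector hL hσ.1 hG hz hX ht
  obtain ⟨P, h1⟩ := exists_isPeripheralProjection (hG1.mem_span_real_eigenvectors hL1 hσ.1)
    fun X z hz hX => hG1.apply_apply_of_unit_eigenvector hL1 hσ.1 (z := z) hz (X := X) hX
  have hP := h1.isFaithfulIdempotent hL1 hσ.1 (hG1.map_self hL1)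
  have h := h1.semigroup hfix
  have hTP : ∀ t : ℝ, 0 ≤ t → ∀ X, expSemigroup L t (P X) = P X := fun t ht X => by
    refine Submodule.span_induction (p := fun X _ => expSemigroup L t X = X) ?_ ?_ ?_ ?_
      (h1.apply_mem X)
    · rintro X ⟨z, hz, hX⟩
      exact hfix X z hz hX t ht
    · simp
    · intro X Y _ _ hX hY
      rw [map_add, hX, hY]
    · intro c X _ hX
      rw [map_smul, hX]
  have hPT : ∀ t : ℝ, 0 ≤ t → ∀ X, P (expSemigroup L t X) = P X := fun t ht X => by
    obtain ⟨k, -, hk⟩ := h1.exists_tendsto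
    -- `P` is a limit of powers of the time-one map, so it commutes with every `T_t`, which in turn
    -- fixes the range of `P`.
    rw [comm_of_tendsto (R := fun _ => expSemigroup L t) (Q := expSemigroup L t) (fun i j X => ?_)
      hk (fun X => tendsto_const_nhds) X, hTP t ht]
    rw [← expSemigroup_natCast, expSemigroup_comm]
  have ht2 : 0 ≤ 2 * t := by positivity
  have heq := semigroupPeripheralProjection_eq (fun s t _ _ => expSemigroup_comm L s t) h
  rw [heq]
  refine ⟨holevo_sub_le hP (hL _ ht2) (hPT _ ht2) fun ρ hρ =>
    realRelEntropy_semigroup_le_expNeg_alpha hL heq hP hPT hTP ht hρ,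
    channelCoherentInfo_sub_le hP (hL _ ht2) (hPT _ ht2) fun ω hω => ?_⟩
  have hd : 0 < d := by
    rcases Nat.eq_zero_or_pos d with rfl | hd
    · exact absurd hσ.2 (by simp [Matrix.trace])
    · exact hd
  have hcomm : ∀ s t : ℝ, 0 ≤ s → 0 ≤ t → ∀ X, idTensor (Fin d) (expSemigroup L s)
      (idTensor (Fin d) (expSemigroup L t) X) = idTensor (Fin d) (expSemigroup L t)
      (idTensor (Fin d) (expSemigroup L s) X) := fun s t _ _ X => by
    rw [← idTensor_idTensor_apply, ← idTensor_idTensor_apply, ← expSemigroup_add,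
      ← expSemigroup_add, add_comm]
  have heq' := semigroupPeripheralProjection_eq hcomm h.idTensor
  have h3 := realRelEntropy_semigroup_le_expNeg_alpha (fun t ht => (hL t ht).idTensor) heq'
    (hP.idTensor (m := Fin d))
    (fun t ht X => congrArg (fun A => idTensor (Fin d) A X)
      (LinearMap.ext (hPT t ht) : P * expSemigroup L t = P))
    (fun t ht X => congrArg (fun A => idTensor (Fin d) A X)
      (LinearMap.ext (hTP t ht) : expSemigroup L t * P = P)) ht hω
  refine h3.trans (expNeg_mul_log_mono (semigroupAlphaC_le _ hd) (le_pimsnerPopaC P hd) ?_)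
  refine le_trans ?_ (hP.idTensor.realRelEntropy_le_log_pimsnerPopa hω)
  exact_mod_cast hP.idTensor.realRelEntropy_nonneg hω.1

end Main

end

end QDyn

theorem mainTheorem4 {d : ℕ} :
    (∀ (Φ : SuperOp (Fin d)) (σ : Matrix (Fin d) (Fin d) ℂ),
      IsChannel Φ → IsFaithfulState σ → IsGNSSymmetric Φ σ →
      ∀ t : ℕ, 0 < t →
        holevo (Φ ^ (2 * t)) - holevo (peripheralProjection Φ) ≤
            expNeg (2 * alpha Φ * t) *
              ENNReal.log (pimsnerPopa (peripheralProjection Φ)) ∧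
        channelCoherentInfo (Φ ^ (2 * t)) - channelCoherentInfo (peripheralProjection Φ) ≤
            expNeg (2 * alphaC Φ * t) *
              ENNReal.log (pimsnerPopaC (peripheralProjection Φ))) ∧
    (∀ (L : SuperOp (Fin d)) (σ : Matrix (Fin d) (Fin d) ℂ),
      IsLindbladian L → IsFaithfulState σ →
      (∀ t : ℝ, 0 ≤ t → IsGNSSymmetric (expSemigroup L t) σ) →
      ∀ t : ℝ, 0 < t →
        holevo (expSemigroup L (2 * t)) -
              holevo (semigroupPeripheralProjection (expSemigroup L)) ≤
            expNeg (2 * semigroupAlpha (expSemigroup L) * ENNReal.ofReal t) *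
              ENNReal.log (pimsnerPopa (semigroupPeripheralProjection (expSemigroup L))) ∧
        channelCoherentInfo (expSemigroup L (2 * t)) -
              channelCoherentInfo (semigroupPeripheralProjection (expSemigroup L)) ≤
            expNeg (2 * semigroupAlphaC (expSemigroup L) * ENNReal.ofReal t) *
              ENNReal.log (pimsnerPopaC (semigroupPeripheralProjection (expSemigroup L)))) :=
  ⟨fun _ _ hΦ hσ hG t _ => discrete_bound hΦ hσ hG t,
    fun _ _ hL hσ hG _ ht => semigroup_bound hL hσ hG ht.le⟩
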